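/- Let $k$ be an algebraically closed field of characteristic $p>0$, let $q=p^n$ with $n\geq 1$, and let $f(y)=y^{q-1}+\mu_2y^{q-2}+\ldots+\mu_q$ and $g(y)=y^{q-1}+\mu'_2y^{q-2}+\ldots+\mu'_q$ be monic polynomials of degree $q-1$ over $k$. Put $$P(w)=w^qf(1/w)=w+\mu_2w^2+\ldots+\mu_qw^q,\qquad Q(w')=w'^qg(1/w')=w'+\mu'_2w'^2+\ldots+\mu'_qw'^q,$$ and $$A=k[[u,w,u',w']]/(u^q-uw^{q-1}-P(w),\ u'^q-u'w'^{q-1}-Q(w')).$$ Let $G=\mathbb{F}_q=\{\lambda\in k\mid\lambda^q=\lambda\}$, as an additive group, act on $A$ by the $k$-algebra automorphisms induced by the substitutions $u\mapsto u+\lambda w$, $u'\mapsto u'+\lambda w'$, $w\mapsto w$, $w'\mapsto w'$ of power series. Then the canonical homomorphism $k[[u,u']]\to A$ is bijective, and the homomorphism of $k$-algebras $$k[[a,b,c]]/(c^q-(ab)^{q-1}c-a^qQ(b)+b^qP(a))\longrightarrow A^G$$ induced by the substitution $a\mapsto w$, $b\mapsto w'$, $c\mapsto wu'-w'u$ is bijective.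 -/

import Mathlib

namespace ArtinSchreierProduct

noncomputable section

/-- The group `G = 𝔽_q ⊂ k` of all scalars `c` with `c ^ q = c`, under addition,
where `q = p ^ n`. -/
def scalarGroup (k : Type*) [Field k] (p : ℕ) [Fact p.Prime] [CharP k p] (n : ℕ) :
    AddSubgroup k where
  carrier := {c | c ^ p ^ n = c}
  zero_mem' := by
    exact zero_pow (pow_ne_zero _ (Fact.out : p.Prime).ne_zero)
  add_mem' := by
    intro a b ha hb
    simp only [Set.mem_ofPred_eq] at ha hb ⊢
    rw [add_pow_char_pow, ha, hb]
  neg_mem' := by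
    intro a ha
    simp only [Set.mem_ofPred_eq] at ha ⊢
    have h := sub_pow_char_pow (p := p) (n := n) (0 : k) a
    have h0 : (0 : k) ^ p ^ n = 0 :=
      zero_pow (pow_ne_zero _ (Fact.out : p.Prime).ne_zero)
    rw [h0, zero_sub, zero_sub, ha] at h
    exact h

/-- For a monic `f = y ^ (q - 1) + μ₂ y ^ (q - 2) + ... + μ_q` of degree `q - 1`, the polynomial
`w ^ q * f (1 / w) = w + μ₂ w ^ 2 + ... + μ_q w ^ q`. -/
def tailPoly {k : Type*} [Field k] (q : ℕ) (f : Polynomial k) : Polynomial k :=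
  ∑ i ∈ Finset.range q, Polynomial.C (f.coeff (q - 1 - i)) * Polynomial.X ^ (i + 1)

/-- For elements `u`, `w` of a `k`-algebra: `u ^ q - u w ^ (q - 1) - P(w)`. -/
def curveEq {k : Type*} [Field k] (q : ℕ) (f : Polynomial k) {B : Type*} [CommRing B]
    [Algebra k B] (u w : B) : B :=
  u ^ q - u * w ^ (q - 1) - Polynomial.aeval w (tailPoly q f)

/-- For elements `a`, `b`, `c` of a `k`-algebra:
`c ^ q - (a b) ^ (q - 1) c - a ^ q Q(b) + b ^ q P(a)`, where `P`, `Q` come from `f`, `g`. -/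
def surfaceEq {k : Type*} [Field k] (q : ℕ) (f g : Polynomial k) {B : Type*} [CommRing B]
    [Algebra k B] (a b c : B) : B :=
  c ^ q - (a * b) ^ (q - 1) * c - a ^ q * Polynomial.aeval b (tailPoly q g)
    + b ^ q * Polynomial.aeval a (tailPoly q f)

lemma map_curveEq {k : Type*} [Field k] (q : ℕ) (f : Polynomial k) {B B' : Type*} [CommRing B]
    [Algebra k B] [CommRing B'] [Algebra k B'] (φ : B →ₐ[k] B') (u w : B) :
    φ (curveEq q f u w) = curveEq q f (φ u) (φ w) := by
  simp [curveEq, Polynomial.aeval_algHom_apply]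

lemma map_surfaceEq {k : Type*} [Field k] (q : ℕ) (f g : Polynomial k) {B B' : Type*}
    [CommRing B] [Algebra k B] [CommRing B'] [Algebra k B'] (φ : B →ₐ[k] B') (a b c : B) :
    φ (surfaceEq q f g a b c) = surfaceEq q f g (φ a) (φ b) (φ c) := by
  simp [surfaceEq, Polynomial.aeval_algHom_apply]

/-- The power series ring `k[[u, w, u', w']]`, with `u, w, u', w'` the variables number
`0, 1, 2, 3`. -/
abbrev Series4 (k : Type*) [Field k] : Type _ := MvPowerSeries (Fin 4) k

/-- The ideal `(u ^ q - u w ^ (q - 1) - P(w), u' ^ q - u' w' ^ (q - 1) - Q(w'))`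
of `k[[u, w, u', w']]`. -/
def productIdeal {k : Type*} [Field k] (q : ℕ) (f g : Polynomial k) : Ideal (Series4 k) :=
  Ideal.span {curveEq q f (MvPowerSeries.X 0 : Series4 k) (MvPowerSeries.X 1),
    curveEq q g (MvPowerSeries.X 2 : Series4 k) (MvPowerSeries.X 3)}

/-- The ring `A = k[[u, w, u', w']] / (u ^ q - u w ^ (q - 1) - P(w), u' ^ q - u' w' ^ (q - 1)
- Q(w'))`. -/
abbrev ProductRing {k : Type*} [Field k] (q : ℕ) (f g : Polynomial k) : Type _ :=
  Series4 k ⧸ productIdeal q f g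

/-- The `k`-algebra homomorphism `k[[u, u']] → A` with `u ↦ u`, `u' ↦ u'`. -/
def coordinateMap {k : Type*} [Field k] (q : ℕ) (f g : Polynomial k) :
    MvPowerSeries (Fin 2) k →ₐ[k] ProductRing q f g :=
  (Ideal.Quotient.mkₐ k (productIdeal q f g)).comp
    (MvPowerSeries.substAlgHom (R := k) (S := k)
      (MvPowerSeries.HasSubst.X_X (i := (0 : Fin 4)) (j := 2)))

/-- The values `u + c w, w, u' + c w', w'` of the linear substitution attached to `c`. -/
def shiftVec {k : Type*} [Field k] (c : k) : Fin 4 → Series4 k :=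
  ![MvPowerSeries.X 0 + MvPowerSeries.C c * MvPowerSeries.X 1, MvPowerSeries.X 1,
    MvPowerSeries.X 2 + MvPowerSeries.C c * MvPowerSeries.X 3, MvPowerSeries.X 3]

lemma hasSubst_shiftVec {k : Type*} [Field k] (c : k) : MvPowerSeries.HasSubst (shiftVec c) := by
  apply MvPowerSeries.hasSubst_of_constantCoeff_zero
  intro s
  fin_cases s <;> simp [shiftVec]

/-- The substitution `u ↦ u + c w, w ↦ w, u' ↦ u' + c w', w' ↦ w'` on `k[[u, w, u', w']]`. -/
def shift {k : Type*} [Field k] (c : k) : Series4 k →ₐ[k] Series4 k :=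
  MvPowerSeries.substAlgHom (hasSubst_shiftVec c)

lemma shift_X {k : Type*} [Field k] (c : k) (i : Fin 4) :
    shift c (MvPowerSeries.X i) = shiftVec c i :=
  MvPowerSeries.substAlgHom_X _ i

lemma shift_C {k : Type*} [Field k] (c d : k) :
    shift c (MvPowerSeries.C d : Series4 k) = MvPowerSeries.C d :=
  (shift c).commutes d

lemma shift_zero {k : Type*} [Field k] (x : Series4 k) : shift (0 : k) x = x := by
  have h : shiftVec (0 : k) = MvPowerSeries.X := by
    funext i
    fin_cases i <;> simp [shiftVec]
  rw [shift, MvPowerSeries.substAlgHom_apply, h, MvPowerSeries.subst_self, id]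

lemma shift_shift {k : Type*} [Field k] (c d : k) (x : Series4 k) :
    shift c (shift d x) = shift (c + d) x := by
  have h : (fun s ↦ MvPowerSeries.subst (shiftVec c) (shiftVec d s)) = shiftVec (c + d) := by
    funext s
    rw [← MvPowerSeries.substAlgHom_apply (R := k) (hasSubst_shiftVec c)]
    change shift c (shiftVec d s) = _
    fin_cases s
    · simp only [Fin.zero_eta, shiftVec, Matrix.cons_val_zero, map_add, map_mul, shift_X, shift_C,
        Matrix.cons_val_one]
      ring
    · simp [shiftVec, shift_X]
    · simp only [shiftVec, Fin.reduceFinMk, Matrix.cons_val, map_add, map_mul, shift_X, shift_C]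
      ring
    · simp [shiftVec, shift_X]
  simp only [shift, MvPowerSeries.substAlgHom_apply]
  rw [MvPowerSeries.subst_comp_subst_apply (hasSubst_shiftVec d) (hasSubst_shiftVec c), h]

lemma curveEq_shift {k : Type*} [Field k] {p : ℕ} [Fact p.Prime] [CharP k p] {n : ℕ}
    (f : Polynomial k) (c : scalarGroup k p n) (x y : Series4 k) :
    curveEq (p ^ n) f (x + MvPowerSeries.C (c : k) * y) y = curveEq (p ^ n) f x y := by
  have : CharP (Series4 k) p := charP_of_injective_algebraMap
    (FaithfulSMul.algebraMap_injective k (Series4 k)) p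
  have hc : (c : k) ^ p ^ n = c := c.2
  have hq : 0 < p ^ n := pow_pos (Fact.out : p.Prime).pos n
  have hy : y ^ p ^ n = y * y ^ (p ^ n - 1) := by
    rw [← pow_succ', Nat.sub_add_cancel hq]
  simp only [curveEq]
  rw [add_pow_char_pow, mul_pow, ← map_pow, hc, hy]
  ring

lemma productIdeal_le_comap {k : Type*} [Field k] {p : ℕ} [Fact p.Prime] [CharP k p] {n : ℕ}
    (f g : Polynomial k) (c : scalarGroup k p n) :
    productIdeal (p ^ n) f g ≤ (productIdeal (p ^ n) f g).comap (shift (c : k)) := by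
  conv_lhs => rw [productIdeal]
  rw [Ideal.span_le]
  rintro x (rfl | rfl)
  · rw [SetLike.mem_coe, Ideal.mem_comap, map_curveEq, shift_X, shift_X]
    refine Ideal.subset_span (Or.inl ?_)
    exact curveEq_shift f c _ _
  · rw [SetLike.mem_coe, Ideal.mem_comap, map_curveEq, shift_X, shift_X]
    refine Ideal.subset_span (Or.inr ?_)
    exact curveEq_shift g c _ _

/-- The endomorphism of `A` with `u ↦ u + c w, w ↦ w, u' ↦ u' + c w', w' ↦ w'`. -/
def actionHom {k : Type*} [Field k] {p : ℕ} [Fact p.Prime] [CharP k p] {n : ℕ}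
    (f g : Polynomial k) (c : scalarGroup k p n) :
    ProductRing (p ^ n) f g →ₐ[k] ProductRing (p ^ n) f g :=
  Ideal.quotientMapₐ _ (shift (c : k)) (productIdeal_le_comap f g c)

lemma actionHom_mk {k : Type*} [Field k] {p : ℕ} [Fact p.Prime] [CharP k p] {n : ℕ}
    (f g : Polynomial k) (c : scalarGroup k p n) (x : Series4 k) :
    actionHom f g c (Ideal.Quotient.mkₐ k (productIdeal (p ^ n) f g) x) =
      Ideal.Quotient.mkₐ k (productIdeal (p ^ n) f g) (shift (c : k) x) :=
  rfl

/-- The diagonal action of the additive group `G = 𝔽_q` on `A`. -/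
instance action {k : Type*} [Field k] {p : ℕ} [Fact p.Prime] [CharP k p] {n : ℕ}
    (f g : Polynomial k) :
    MulSemiringAction (Multiplicative (scalarGroup k p n)) (ProductRing (p ^ n) f g) where
  smul c := actionHom f g c.toAdd
  one_smul x := by
    obtain ⟨x, rfl⟩ := Ideal.Quotient.mkₐ_surjective k (productIdeal (p ^ n) f g) x
    change actionHom f g 0 _ = _
    rw [actionHom_mk, ZeroMemClass.coe_zero, shift_zero]
  mul_smul c d x := by
    obtain ⟨x, rfl⟩ := Ideal.Quotient.mkₐ_surjective k (productIdeal (p ^ n) f g) x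
    change actionHom f g (c.toAdd + d.toAdd) _ = actionHom f g c.toAdd (actionHom f g d.toAdd _)
    rw [actionHom_mk, actionHom_mk, actionHom_mk, shift_shift, AddSubgroup.coe_add]
  smul_zero c := map_zero (actionHom f g c.toAdd)
  smul_add c := map_add (actionHom f g c.toAdd)
  smul_one c := map_one (actionHom f g c.toAdd)
  smul_mul c := map_mul (actionHom f g c.toAdd)

/-- The invariant ring `A ^ G`. -/
def invariantRing {k : Type*} [Field k] (p : ℕ) [Fact p.Prime] [CharP k p] (n : ℕ)
    (f g : Polynomial k) : Subalgebra k (ProductRing (p ^ n) f g) where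
  carrier := {x | ∀ c : Multiplicative (scalarGroup k p n), c • x = x}
  mul_mem' hx hy c := by rw [smul_mul', hx c, hy c]
  add_mem' hx hy c := by rw [smul_add, hx c, hy c]
  algebraMap_mem' r c := (actionHom f g c.toAdd).commutes r

/-- The ring `k[[a, b, c]] / (c ^ q - (a b) ^ (q - 1) c - a ^ q Q(b) + b ^ q P(a))`, with
`a, b, c` the variables number `0, 1, 2`. -/
abbrev SurfaceRing {k : Type*} [Field k] (q : ℕ) (f g : Polynomial k) : Type _ :=
  MvPowerSeries (Fin 3) k ⧸ Ideal.span
    {surfaceEq q f g (MvPowerSeries.X 0 : MvPowerSeries (Fin 3) k) (MvPowerSeries.X 1)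
      (MvPowerSeries.X 2)}

/-- The values `w, w', w u' - w' u`. -/
def invariantVec (k : Type*) [Field k] : Fin 3 → Series4 k :=
  ![MvPowerSeries.X 1, MvPowerSeries.X 3,
    MvPowerSeries.X 1 * MvPowerSeries.X 2 - MvPowerSeries.X 3 * MvPowerSeries.X 0]

lemma hasSubst_invariantVec (k : Type*) [Field k] : MvPowerSeries.HasSubst (invariantVec k) := by
  apply MvPowerSeries.hasSubst_of_constantCoeff_zero
  intro s
  fin_cases s <;> simp [invariantVec]

/-- The substitution `a ↦ w, b ↦ w', c ↦ w u' - w' u` from `k[[a, b, c]]` to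
`k[[u, w, u', w']]`. -/
def invariantSubst (k : Type*) [Field k] : MvPowerSeries (Fin 3) k →ₐ[k] Series4 k :=
  MvPowerSeries.substAlgHom (hasSubst_invariantVec k)

lemma shift_invariantSubst {k : Type*} [Field k] (c : k) (x : MvPowerSeries (Fin 3) k) :
    shift c (invariantSubst k x) = invariantSubst k x := by
  have h : (fun s ↦ MvPowerSeries.subst (shiftVec c) (invariantVec k s)) = invariantVec k := by
    funext s
    rw [← MvPowerSeries.substAlgHom_apply (R := k) (hasSubst_shiftVec c)]
    change shift c (invariantVec k s) = _
    fin_cases s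
    · simp [invariantVec, shift_X, shiftVec]
    · simp [invariantVec, shift_X, shiftVec]
    · simp only [invariantVec, shiftVec, Fin.reduceFinMk, Matrix.cons_val, map_sub, map_mul,
        shift_X]
      ring
  simp only [shift, invariantSubst, MvPowerSeries.substAlgHom_apply]
  rw [MvPowerSeries.subst_comp_subst_apply (hasSubst_invariantVec k) (hasSubst_shiftVec c), h]

lemma invariantSubst_surfaceEq {k : Type*} [Field k] {p : ℕ} [Fact p.Prime] [CharP k p] {n : ℕ}
    (f g : Polynomial k) :
    invariantSubst k (surfaceEq (p ^ n) f g (MvPowerSeries.X 0) (MvPowerSeries.X 1)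
      (MvPowerSeries.X 2)) ∈ productIdeal (p ^ n) f g := by
  have : CharP (Series4 k) p := charP_of_injective_algebraMap
    (FaithfulSMul.algebraMap_injective k (Series4 k)) p
  have hq : 0 < p ^ n := pow_pos (Fact.out : p.Prime).pos n
  have hy (y : Series4 k) : y ^ p ^ n = y * y ^ (p ^ n - 1) := by
    rw [← pow_succ', Nat.sub_add_cancel hq]
  have hX (i : Fin 3) : invariantSubst k (MvPowerSeries.X i) = invariantVec k i :=
    MvPowerSeries.substAlgHom_X _ i
  have key : invariantSubst k (surfaceEq (p ^ n) f g (MvPowerSeries.X 0) (MvPowerSeries.X 1)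
      (MvPowerSeries.X 2)) =
      (MvPowerSeries.X 1 : Series4 k) ^ p ^ n *
        curveEq (p ^ n) g (MvPowerSeries.X 2 : Series4 k) (MvPowerSeries.X 3) -
      (MvPowerSeries.X 3 : Series4 k) ^ p ^ n *
        curveEq (p ^ n) f (MvPowerSeries.X 0 : Series4 k) (MvPowerSeries.X 1) := by
    rw [map_surfaceEq, hX, hX, hX]
    simp only [invariantVec, Matrix.cons_val, surfaceEq, curveEq]
    rw [sub_pow_char_pow, mul_pow, mul_pow, mul_pow]
    rw [hy (MvPowerSeries.X 1), hy (MvPowerSeries.X 3)]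
    ring
  rw [key]
  exact Ideal.sub_mem _ (Ideal.mul_mem_left _ _ (Ideal.subset_span (Or.inr rfl)))
    (Ideal.mul_mem_left _ _ (Ideal.subset_span (Or.inl rfl)))

/-- The homomorphism `k[[a, b, c]] / (c ^ q - (a b) ^ (q - 1) c - a ^ q Q(b) + b ^ q P(a)) → A ^ G`
of `k`-algebras with `a ↦ w, b ↦ w', c ↦ w u' - w' u`. -/
def invariantMap {k : Type*} [Field k] (p : ℕ) [Fact p.Prime] [CharP k p] (n : ℕ)
    (f g : Polynomial k) : SurfaceRing (p ^ n) f g →ₐ[k] invariantRing p n f g :=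
  Ideal.Quotient.liftₐ _
    (((Ideal.Quotient.mkₐ k (productIdeal (p ^ n) f g)).comp (invariantSubst k)).codRestrict
      (invariantRing p n f g) (by
        intro x c
        change actionHom f g c.toAdd (Ideal.Quotient.mkₐ k _ (invariantSubst k x)) =
          Ideal.Quotient.mkₐ k _ (invariantSubst k x)
        rw [actionHom_mk, shift_invariantSubst]))
    (by
      intro x hx
      rw [← RingHom.mem_ker]
      refine (Ideal.span_le.mpr ?_) hx
      rintro y rfl
      rw [SetLike.mem_coe, RingHom.mem_ker]
      apply Subtype.ext
      exact Ideal.Quotient.eq_zero_iff_mem.mpr (invariantSubst_surfaceEq f g))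

end

end ArtinSchreierProduct

/-! Write `P`, `Q` for the two tail polynomials. Their linear coefficient is 1, so the equations of
`A` read `w = V`, `w' = V'` with `V`, `V'` of order at least 2, and `w`, `w'` can be eliminated in
favour of `u`, `u'`. Read instead as `u ^ q = V`, `u' ^ q = V'` with `w ∣ V` and `w' ∣ V'`, they
make `A` free over `R = k[[w, w']]` with basis `u ^ i * u' ^ j`, `i, j < q`. Both facts are
Weierstrass division by two series at once (`exists_division₂`, with uniqueness of the remainder in
`eq_zero_of_mem_span`), for two different weightings of the variables.

For the invariants put `c = w u' - w' u`. Once `w` is inverted, `R[u, u']` and `R[u, c]` agree. Both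
`u` and `c` satisfy equations of degree `q` over `R`, so the `q ^ 2` products `u ^ i * c ^ j` span,
and by counting they are independent (`linearIndependent_mul_pow`). A scalar `λ` in `G` fixes `c`
and sends `u` to `u + λ w`. Expand an invariant, times a power of `w`, in powers of `c`: each
coefficient is a polynomial in `u` of degree below `q` unchanged by `q` translations, hence constant
(`exists_pow_smul_eq_sum`).

The power of `w` cancels because `c ≡ -w' u` modulo `w`, and `w` is a prime not dividing `w'`
(`exists_eq_sum_of_pow_smul`). Thus the invariants are the `R`-combinations of `c ^ j`, `j < q`.
Weierstrass division in `c` shows that the same powers span the surface ring over `R`, and their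
independence in `A` gives injectivity. -/

namespace ArtinSchreierProduct

/-! ### Weierstrass division for power series, by contraction in a weighted order. -/

section Division

open MvPowerSeries

variable {σ R : Type*} [CommRing R]

/-- An additive endomorphism of a power series ring which raises a weighted order by one has no
nonzero fixed points. -/
lemma eq_zero_of_fixed (wt : σ → ℕ) (θ : MvPowerSeries σ R →+ MvPowerSeries σ R)
    (hθ : ∀ (N : ℕ) x, (N : ℕ∞) ≤ x.weightedOrder wt → ((N + 1 : ℕ) : ℕ∞) ≤ (θ x).weightedOrder wt)
    {x : MvPowerSeries σ R} (hx : θ x = x) : x = 0 := by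
  have h (N : ℕ) : (N : ℕ∞) ≤ x.weightedOrder wt := by
    induction N with
    | zero => simp
    | succ N ih => simpa only [hx] using hθ N x ih
  ext e
  exact coeff_eq_zero_of_lt_weightedOrder wt
    (lt_of_lt_of_le (by exact_mod_cast Nat.lt_succ_self _) (h (Finsupp.weight wt e + 1)))

/-- If an additive endomorphism `θ` of a power series ring raises a weighted order by one,
then `1 - θ` is surjective. -/
lemma exists_sub_eq (wt : σ → ℕ) (θ : MvPowerSeries σ R →+ MvPowerSeries σ R)
    (hθ : ∀ (N : ℕ) x, (N : ℕ∞) ≤ x.weightedOrder wt → ((N + 1 : ℕ) : ℕ∞) ≤ (θ x).weightedOrder wt)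
    (x : MvPowerSeries σ R) : ∃ y, y - θ y = x := by
  have hit (N : ℕ) : (N : ℕ∞) ≤ ((θ^[N]) x).weightedOrder wt := by
    induction N with
    | zero => simp
    | succ N ih => rw [Function.iterate_succ_apply']; exact hθ N _ ih
  set S : ℕ → MvPowerSeries σ R := fun N ↦ ∑ i ∈ Finset.range N, (θ^[i]) x with hS
  have hSS (N : ℕ) : S N - θ (S N) = x - (θ^[N]) x := by
    induction N with
    | zero => simp [hS]
    | succ N ih =>
      have : S (N + 1) = S N + (θ^[N]) x := Finset.sum_range_succ _ _
      rw [this, map_add, Function.iterate_succ_apply']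
      linear_combination ih
  have hcoeff {N : ℕ} {z : MvPowerSeries σ R} (hz : (N : ℕ∞) ≤ z.weightedOrder wt) {e : σ →₀ ℕ}
      (he : Finsupp.weight wt e < N) : coeff e z = 0 :=
    coeff_eq_zero_of_lt_weightedOrder wt (lt_of_lt_of_le (by exact_mod_cast he) hz)
  -- The coefficient of `S N` at `e` is constant once `N` exceeds the weight of `e`. The limit is
  -- therefore taken coefficientwise, even when infinitely many exponents share a weight, as happens
  -- for variables of weight 0.
  let y : MvPowerSeries σ R := fun e ↦ coeff e (S (Finsupp.weight wt e + 1))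
  have hy (N : ℕ) : (N : ℕ∞) ≤ (y - S N).weightedOrder wt := by
    refine le_weightedOrder wt fun e he ↦ ?_
    have he : Finsupp.weight wt e < N := by exact_mod_cast he
    have h1 : coeff e y = coeff e (S (Finsupp.weight wt e + 1)) := rfl
    rw [map_sub, h1, sub_eq_zero]
    induction N, he using Nat.le_induction with
    | base => rfl
    | succ N hN ih =>
      have : S (N + 1) = S N + (θ^[N]) x := Finset.sum_range_succ _ _
      rw [this, map_add, hcoeff (hit N) hN, add_zero]
      exact ih (by exact_mod_cast hN)
  refine ⟨y, ?_⟩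
  ext e
  set N := Finsupp.weight wt e + 1 with hN
  have h1 := hcoeff (hy N) (e := e) (by omega)
  have h2 := hcoeff (hθ N _ (hy N)) (e := e) (by omega)
  have h3 := hcoeff (hit N) (e := e) (by omega)
  have h4 := congrArg (coeff e) (hSS N)
  simp only [map_sub, h3] at h1 h2 h4 ⊢
  linear_combination h1 - h2 + h4

/-- The quotient of a power series by `X s ^ m`, dropping the monomials not divisible
by `X s ^ m`. -/
noncomputable def quo (s : σ) (m : ℕ) : MvPowerSeries σ R →+ MvPowerSeries σ R where
  toFun G := fun e ↦ coeff (e + Finsupp.single s m) G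
  map_zero' := funext fun _ ↦ map_zero _
  map_add' _ _ := funext fun _ ↦ map_add _ _ _

lemma coeff_quo (s : σ) (m : ℕ) (G : MvPowerSeries σ R) (e : σ →₀ ℕ) :
    coeff e (quo s m G) = coeff (e + Finsupp.single s m) G := rfl

/-- The monomials of a power series that are not divisible by `X s ^ m`. -/
noncomputable def rem (s : σ) (m : ℕ) : MvPowerSeries σ R →+ MvPowerSeries σ R where
  toFun G := fun e ↦ if e s < m then coeff e G else 0
  map_zero' := funext fun e ↦ by
    change (if e s < m then coeff e (0 : MvPowerSeries σ R) else 0) = 0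
    rw [map_zero, ite_self]
  map_add' x y := funext fun e ↦ by
    change (if e s < m then coeff e (x + y) else 0) =
      (if e s < m then coeff e x else 0) + (if e s < m then coeff e y else 0)
    split_ifs <;> simp

lemma coeff_rem (s : σ) (m : ℕ) (G : MvPowerSeries σ R) (e : σ →₀ ℕ) :
    coeff e (rem s m G) = if e s < m then coeff e G else 0 := rfl

lemma rem_add_quo (s : σ) (m : ℕ) (G : MvPowerSeries σ R) :
    rem s m G + X s ^ m * quo s m G = G := by
  classical
  ext e
  rw [map_add, X_pow_eq, coeff_monomial_mul, coeff_rem, coeff_quo]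
  by_cases h : e s < m
  · rw [if_pos h, if_neg, add_zero]
    intro h'
    have := h' s
    simp at this
    omega
  · have h' : Finsupp.single s m ≤ e := by
      simpa using h
    rw [if_neg h, if_pos h', tsub_add_cancel_of_le h', zero_add, one_mul]

lemma rem_eq_self {s : σ} {m : ℕ} {G : MvPowerSeries σ R}
    (h : ∀ e : σ →₀ ℕ, m ≤ e s → coeff e G = 0) : rem s m G = G := by
  ext e
  rw [coeff_rem]
  split_ifs with he
  · rfl
  · exact (h e (not_lt.mp he)).symm

lemma coeff_rem_of_le {s : σ} {m : ℕ} (G : MvPowerSeries σ R) {e : σ →₀ ℕ} (h : m ≤ e s) :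
    coeff e (rem s m G) = 0 := by
  rw [coeff_rem, if_neg (not_lt.mpr h)]

lemma quo_eq_zero {s : σ} {m : ℕ} {G : MvPowerSeries σ R}
    (h : ∀ e : σ →₀ ℕ, m ≤ e s → coeff e G = 0) : quo s m G = 0 := by
  ext e
  rw [coeff_quo]
  exact h _ (by simp)

lemma quo_X_pow_mul (s : σ) (m : ℕ) (G : MvPowerSeries σ R) : quo s m (X s ^ m * G) = G := by
  ext e
  rw [coeff_quo, X_pow_eq, add_comm, coeff_add_monomial_mul, one_mul]

lemma rem_X_pow_mul (s : σ) (m : ℕ) (G : MvPowerSeries σ R) : rem s m (X s ^ m * G) = 0 := by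
  have h := rem_add_quo s m (X s ^ m * G)
  rwa [quo_X_pow_mul, add_eq_right] at h

lemma rem_weightedOrder (wt : σ → ℕ) (s : σ) (m : ℕ) (G : MvPowerSeries σ R) {N : ℕ}
    (h : (N : ℕ∞) ≤ G.weightedOrder wt) : (N : ℕ∞) ≤ (rem s m G).weightedOrder wt := by
  refine le_weightedOrder wt fun e he ↦ ?_
  rw [coeff_rem, coeff_eq_zero_of_lt_weightedOrder wt (lt_of_lt_of_le he h), ite_self]

lemma mul_quo_weightedOrder (wt : σ → ℕ) (s : σ) (m : ℕ) {V : MvPowerSeries σ R}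
    (hV : ((m * wt s + 1 : ℕ) : ℕ∞) ≤ V.weightedOrder wt) (G : MvPowerSeries σ R) {N : ℕ}
    (h : (N : ℕ∞) ≤ G.weightedOrder wt) :
    ((N + 1 : ℕ) : ℕ∞) ≤ (V * quo s m G).weightedOrder wt := by
  -- The subtraction is truncated. If `N < m * wt s` it gives 0, and the weight of `V` alone
  -- suffices below.
  have hq : ((N - m * wt s : ℕ) : ℕ∞) ≤ (quo s m G).weightedOrder wt := by
    refine le_weightedOrder wt fun e he ↦ ?_
    rw [coeff_quo]
    refine coeff_eq_zero_of_lt_weightedOrder wt (lt_of_lt_of_le ?_ h)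
    have he : Finsupp.weight wt e < N - m * wt s := by exact_mod_cast he
    rw [map_add, Finsupp.weight_single, smul_eq_mul]
    exact_mod_cast by omega
  calc ((N + 1 : ℕ) : ℕ∞) ≤ ((m * wt s + 1 : ℕ) : ℕ∞) + ((N - m * wt s : ℕ) : ℕ∞) := by
        exact_mod_cast by omega
    _ ≤ _ := (add_le_add hV hq).trans (le_weightedOrder_mul wt)

/-- Weierstrass division by `X s ^ m - V`, where `V` is of large weight. -/
lemma exists_division (wt : σ → ℕ) (s : σ) (m : ℕ) {V : MvPowerSeries σ R}
    (hV : ((m * wt s + 1 : ℕ) : ℕ∞) ≤ V.weightedOrder wt) (G : MvPowerSeries σ R) :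
    ∃ H K : MvPowerSeries σ R, (∀ e : σ →₀ ℕ, m ≤ e s → coeff e H = 0) ∧
      G = H + (X s ^ m - V) * K := by
  obtain ⟨y, hy⟩ := exists_sub_eq wt ((AddMonoidHom.mulLeft V).comp (quo s m))
    (fun N x hx ↦ mul_quo_weightedOrder wt s m hV x hx) G
  refine ⟨rem s m y, quo s m y, fun e he ↦ coeff_rem_of_le _ he, ?_⟩
  have h := rem_add_quo s m y
  rw [← hy]
  simp only [AddMonoidHom.comp_apply, AddMonoidHom.coe_mulLeft]
  linear_combination -h

/-- Simultaneous Weierstrass division by `X s ^ m - V` and `X t ^ m - V'`. -/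
lemma exists_division₂ (wt : σ → ℕ) (s t : σ) (m : ℕ) {V V' : MvPowerSeries σ R}
    (hV : ((m * wt s + 1 : ℕ) : ℕ∞) ≤ V.weightedOrder wt)
    (hV' : ((m * wt t + 1 : ℕ) : ℕ∞) ≤ V'.weightedOrder wt) (G : MvPowerSeries σ R) :
    ∃ H K L : MvPowerSeries σ R, (∀ e : σ →₀ ℕ, m ≤ e s ∨ m ≤ e t → coeff e H = 0) ∧
      G = H + (X s ^ m - V) * K + (X t ^ m - V') * L := by
  obtain ⟨y, hy⟩ := exists_sub_eq wt ((AddMonoidHom.mulLeft V).comp (quo s m) +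
      (AddMonoidHom.mulLeft V').comp ((quo t m).comp (rem s m)))
    (fun N x hx ↦ (le_min (mul_quo_weightedOrder wt s m hV x hx)
      (mul_quo_weightedOrder wt t m hV' _ (rem_weightedOrder wt s m x hx))).trans
      (min_weightedOrder_le_add wt)) G
  refine ⟨rem t m (rem s m y), quo s m y, quo t m (rem s m y), fun e he ↦ ?_, ?_⟩
  · rw [coeff_rem, coeff_rem]
    split_ifs
    · omega
    all_goals rfl
  · have h := rem_add_quo s m y
    have h' := rem_add_quo t m (rem s m y)
    rw [← hy]
    simp only [AddMonoidHom.add_apply, AddMonoidHom.comp_apply, AddMonoidHom.coe_mulLeft]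
    linear_combination -h - h'

/-- Uniqueness of the remainder of the simultaneous Weierstrass division. -/
lemma eq_zero_of_mem_span (wt : σ → ℕ) {s t : σ} (m : ℕ) (hst : s ≠ t)
    {V V' : MvPowerSeries σ R}
    (hV : ((m * wt s + 1 : ℕ) : ℕ∞) ≤ V.weightedOrder wt)
    (hV' : ((m * wt t + 1 : ℕ) : ℕ∞) ≤ V'.weightedOrder wt) {H : MvPowerSeries σ R}
    (hH : ∀ e : σ →₀ ℕ, m ≤ e s ∨ m ≤ e t → coeff e H = 0)
    (hmem : H ∈ Ideal.span {X s ^ m - V, X t ^ m - V'}) : H = 0 := by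
  classical
  obtain ⟨a, b, hab⟩ := Ideal.mem_span_pair.mp hmem
  obtain ⟨b₀, b₁, hb₀, hb⟩ := exists_division wt s m hV b
  have hX : ∀ e : σ →₀ ℕ, m ≤ e s → coeff e (X t ^ m * b₀) = 0 := by
    intro e he
    rw [X_pow_eq, coeff_monomial_mul]
    split_ifs
    · rw [hb₀, mul_zero]
      simpa [hst.symm] using he
    · rfl
  have hHs : ∀ e : σ →₀ ℕ, m ≤ e s → coeff e H = 0 := fun e he ↦ hH e (Or.inl he)
  have hHt : ∀ e : σ →₀ ℕ, m ≤ e t → coeff e H = 0 := fun e he ↦ hH e (Or.inr he)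
  -- Reducing `b` modulo the first divisor leaves `b₀` of degree below `m` in `X s`; the multiple
  -- `b₁` is absorbed into the cofactor of the first divisor.
  set a' := a + b₁ * (X t ^ m - V') with ha'
  -- Now `H = a' (X s ^ m - V) + b₀ (X t ^ m - V')`, so `y = -V a' - V' b₀`. The quotients of `y`
  -- are `-a'` and `-b₀`, which makes `y` a fixed point of the contraction used for division.
  set y := H - X s ^ m * a' - X t ^ m * b₀ with hy
  have hq : quo s m y = -a' := by
    rw [hy, map_sub, map_sub, quo_eq_zero hHs, quo_X_pow_mul, quo_eq_zero hX]
    ring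
  have hr : rem s m y = H - X t ^ m * b₀ := by
    rw [hy, map_sub, map_sub, rem_eq_self hHs, rem_X_pow_mul, rem_eq_self hX, sub_zero]
  have hqr : quo t m (rem s m y) = -b₀ := by
    rw [hr, map_sub, quo_eq_zero hHt, quo_X_pow_mul, zero_sub]
  have hy0 : y = 0 := by
    refine eq_zero_of_fixed wt ((AddMonoidHom.mulLeft V).comp (quo s m) +
      (AddMonoidHom.mulLeft V').comp ((quo t m).comp (rem s m)))
      (fun N x hx ↦ (le_min (mul_quo_weightedOrder wt s m hV x hx)
      (mul_quo_weightedOrder wt t m hV' _ (rem_weightedOrder wt s m x hx))).trans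
      (min_weightedOrder_le_add wt)) ?_
    simp only [AddMonoidHom.add_apply, AddMonoidHom.comp_apply, AddMonoidHom.coe_mulLeft]
    rw [hq, hqr, hy, ha']
    linear_combination hab - (X t ^ m - V') * hb
  have hb0 : b₀ = 0 := by
    rw [← neg_eq_zero, ← hqr, hy0, map_zero, map_zero]
  rw [hy0, hb0, map_zero] at hr
  simpa using hr.symm

end Division

/-! ### Invariants of translations in a free algebra with basis `u ^ i * v ^ j`. -/

section Invariants

open Polynomial

variable {R A : Type*} [CommRing R] [CommRing A] [Algebra R A]

/-- If `u` and `c` satisfy equations `x ^ q = d x + r` over `R`, then `R[u, c]` is spanned by the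
products `u ^ i * c ^ j` with `i, j < q`. -/
lemma adjoin_le_span {q : ℕ} (hq : 2 ≤ q) {u c : A} {d r d' r' : R}
    (hu : u ^ q = algebraMap R A d * u + algebraMap R A r)
    (hc : c ^ q = algebraMap R A d' * c + algebraMap R A r') {x : A}
    (hx : x ∈ Algebra.adjoin R {u, c}) :
    x ∈ Submodule.span R (Set.range fun i : Fin q × Fin q ↦ u ^ (i.1 : ℕ) * c ^ (i.2 : ℕ)) := by
  set D := Submodule.span R
    (Set.range fun i : Fin q × Fin q ↦ u ^ (i.1 : ℕ) * c ^ (i.2 : ℕ)) with hD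
  have hmem {i j : ℕ} (hi : i < q) (hj : j < q) : u ^ i * c ^ j ∈ D :=
    Submodule.subset_span ⟨(⟨i, hi⟩, ⟨j, hj⟩), rfl⟩
  have hmul {z : A} (hz : ∀ i j, i < q → j < q → z * (u ^ i * c ^ j) ∈ D) {y : A} (hy : y ∈ D) :
      z * y ∈ D := by
    induction hy using Submodule.span_induction with
    | mem y hy => obtain ⟨i, rfl⟩ := hy; exact hz _ _ i.1.2 i.2.2
    | zero => rw [mul_zero]; exact D.zero_mem
    | add y y' _ _ h h' => rw [mul_add]; exact D.add_mem h h'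
    | smul s y _ h => rw [mul_smul_comm]; exact D.smul_mem s h
  have hu' : ∀ y ∈ D, u * y ∈ D := fun y hy ↦ hmul (fun i j hi hj ↦ by
    rcases Nat.lt_or_ge (i + 1) q with h | h
    · rw [show u * (u ^ i * c ^ j) = u ^ (i + 1) * c ^ j by ring]
      exact hmem h hj
    · obtain rfl : q = i + 1 := by omega
      rw [show u * (u ^ i * c ^ j) = d • (u ^ 1 * c ^ j) + r • (u ^ 0 * c ^ j) by
        rw [Algebra.smul_def, Algebra.smul_def]; linear_combination c ^ j * hu]
      exact D.add_mem (D.smul_mem _ (hmem (by omega) hj)) (D.smul_mem _ (hmem (by omega) hj))) hy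
  have hc' : ∀ y ∈ D, c * y ∈ D := fun y hy ↦ hmul (fun i j hi hj ↦ by
    rcases Nat.lt_or_ge (j + 1) q with h | h
    · rw [show c * (u ^ i * c ^ j) = u ^ i * c ^ (j + 1) by ring]
      exact hmem hi h
    · obtain rfl : q = j + 1 := by omega
      rw [show c * (u ^ i * c ^ j) = d' • (u ^ i * c ^ 1) + r' • (u ^ i * c ^ 0) by
        rw [Algebra.smul_def, Algebra.smul_def]; linear_combination u ^ i * hc]
      exact D.add_mem (D.smul_mem _ (hmem hi (by omega))) (D.smul_mem _ (hmem hi (by omega)))) hy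
  -- The span `D` is stable under `u` and `c`, hence under all of `R[u, c]`; it remains to apply
  -- this to `1 = u ^ 0 * c ^ 0`.
  have key : ∀ y ∈ D, x * y ∈ D := by
    induction hx using Algebra.adjoin_induction with
    | mem z hz => rcases hz with rfl | rfl <;> assumption
    | algebraMap s => intro y hy; rw [← Algebra.smul_def]; exact D.smul_mem s hy
    | add z z' _ _ h h' => intro y hy; rw [add_mul]; exact D.add_mem (h y hy) (h' y hy)
    | mul z z' _ _ h h' => intro y hy; rw [mul_assoc]; exact h _ (h' y hy)
  simpa using key _ (hmem (i := 0) (j := 0) (by omega) (by omega))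

/-- If `a v - b u = c`, then every element of `R[u, v]` is carried into `R[u, c]` by a power
of `a`. -/
lemma exists_pow_smul_mem_adjoin {u v c : A} {a b : R}
    (hc : c = algebraMap R A a * v - algebraMap R A b * u) {x : A}
    (hx : x ∈ Algebra.adjoin R {u, v}) : ∃ N : ℕ, a ^ N • x ∈ Algebra.adjoin R {u, c} := by
  have hu : u ∈ Algebra.adjoin R {u, c} := Algebra.subset_adjoin (by simp)
  have hc' : c ∈ Algebra.adjoin R {u, c} := Algebra.subset_adjoin (by simp)
  induction hx using Algebra.adjoin_induction with
  | mem z hz =>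
    rcases hz with rfl | rfl
    · exact ⟨0, by simpa using hu⟩
    · refine ⟨1, ?_⟩
      rw [pow_one, Algebra.smul_def, show algebraMap R A a * z = c + algebraMap R A b * u by
        rw [hc]; ring, ← Algebra.smul_def]
      exact add_mem hc' (Subalgebra.smul_mem _ hu b)
  | algebraMap s => exact ⟨0, by simp⟩
  | add z z' _ _ h h' =>
    obtain ⟨N, h⟩ := h
    obtain ⟨N', h'⟩ := h'
    refine ⟨N + N', ?_⟩
    rw [smul_add, show a ^ (N + N') • z = a ^ N' • a ^ N • z by rw [smul_smul]; ring_nf,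
      show a ^ (N + N') • z' = a ^ N • a ^ N' • z' by rw [smul_smul]; ring_nf]
    exact add_mem (Subalgebra.smul_mem _ h _) (Subalgebra.smul_mem _ h' _)
  | mul z z' _ _ h h' =>
    obtain ⟨N, h⟩ := h
    obtain ⟨N', h'⟩ := h'
    refine ⟨N + N', ?_⟩
    rw [pow_add, ← smul_mul_smul_comm]
    exact mul_mem h h'

/-- A family of as many vectors as a basis, spanning up to multiplication by nonzero scalars, is
linearly independent. -/
lemma linearIndependent_of_smul_mem_span [IsDomain R] {ι : Type*} [Fintype ι] {M : Type*}
    [AddCommGroup M] [Module R M] (B : Module.Basis ι R M) (v : ι → M)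
    (h : ∀ i, ∃ s : R, s ≠ 0 ∧ s • B i ∈ Submodule.span R (Set.range v)) :
    LinearIndependent R v := by
  classical
  have := Module.Free.of_basis B
  have := Module.Finite.of_basis B
  choose s hs hmem using h
  have hmem' : ∀ i, ∃ t : ι → R, ∑ j, t j • v j = s i • B i := fun i ↦
    (Submodule.mem_span_range_iff_exists_fun R).mp (hmem i)
  choose t ht using hmem'
  -- In the basis `B` the composite `φ ∘ₗ ψ` is diagonal with nonzero entries `s i`. Hence `det φ ≠
  -- 0`, and over a domain `φ` is injective.
  let φ : M →ₗ[R] M := B.constr R v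
  let ψ : M →ₗ[R] M := B.constr R fun i ↦ ∑ j, t i j • B j
  have hφψ : φ ∘ₗ ψ = B.constr R fun i ↦ s i • B i := by
    refine B.ext fun i ↦ ?_
    simp only [LinearMap.comp_apply, ψ, φ, Module.Basis.constr_basis, map_sum, map_smul, ht]
  have hdet : LinearMap.det φ ≠ 0 := by
    have hd : LinearMap.det (φ ∘ₗ ψ) = ∏ i, s i := by
      rw [hφψ, ← LinearMap.det_toMatrix B, show LinearMap.toMatrix B B
        (B.constr R fun i ↦ s i • B i) = Matrix.diagonal s by
          ext i j
          rw [LinearMap.toMatrix_apply, Module.Basis.constr_basis, map_smul]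
          simp [Matrix.diagonal_apply, Finsupp.single_apply, eq_comm]
          grind, Matrix.det_diagonal]
    intro h0
    rw [LinearMap.det_comp, h0, zero_mul] at hd
    exact Finset.prod_ne_zero_iff.mpr (fun i _ ↦ hs i) hd.symm
  have hker : LinearMap.ker φ = ⊥ := by
    by_contra h
    exact hdet (LinearMap.det_eq_zero_iff_ker_ne_bot.mpr h)
  have := B.linearIndependent.map' φ hker
  rwa [show (φ ∘ B) = v from funext fun i ↦ B.constr_basis R v i] at this

/-- A polynomial of degree less than `q` that is invariant under `q` distinct translations is
constant. -/
lemma eq_C_of_comp_eq [IsDomain R] {q : ℕ} {S : Polynomial R} (hS : S.natDegree < q)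
    (Λ : Finset R) (hΛ : q ≤ Λ.card) (h : ∀ t ∈ Λ, S.comp (X + C t) = S) :
    S = C (S.eval 0) := by
  -- Evaluating the invariance at 0 gives `S(t) = S(0)`, so `S - S(0)` has at least `q` roots in `Λ`
  -- and degree below `q`.
  rw [← sub_eq_zero]
  refine Polynomial.eq_zero_of_natDegree_lt_card_of_eval_eq_zero' _ Λ (fun t ht ↦ ?_) ?_
  · have := congrArg (Polynomial.eval 0) (h t ht)
    rw [eval_comp] at this
    simpa [sub_eq_zero] using this
  · rw [natDegree_sub_C]
    omega

variable {q : ℕ} {u v c : A} {a b : R}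

/-- A power of `a` carries each basis vector into `R[u, c]`, which these products span; there are as
many products as basis vectors. -/
lemma linearIndependent_mul_pow [IsDomain R] (hq : 2 ≤ q) (B : Module.Basis (Fin q × Fin q) R A)
    (hB : ∀ i, B i = u ^ (i.1 : ℕ) * v ^ (i.2 : ℕ)) (ha : a ≠ 0)
    (hc : c = algebraMap R A a * v - algebraMap R A b * u) {d r d' r' : R}
    (hu : u ^ q = algebraMap R A d * u + algebraMap R A r)
    (hcq : c ^ q = algebraMap R A d' * c + algebraMap R A r') :
    LinearIndependent R fun i : Fin q × Fin q ↦ u ^ (i.1 : ℕ) * c ^ (i.2 : ℕ) := by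
  refine linearIndependent_of_smul_mem_span B _ fun i ↦ ?_
  obtain ⟨N, hN⟩ := exists_pow_smul_mem_adjoin (R := R) (x := B i) hc (by
    rw [hB]
    exact mul_mem (pow_mem (Algebra.subset_adjoin (by simp)) _)
      (pow_mem (Algebra.subset_adjoin (by simp)) _))
  exact ⟨a ^ N, pow_ne_zero _ ha, adjoin_le_span hq hu hcq hN⟩

/-- Up to a power of `a`, every element fixed by `q` distinct translations `u ↦ u + t` that fix
`c` is a combination of powers of `c`. -/
lemma exists_pow_smul_eq_sum [IsDomain R] (hq : 2 ≤ q) (B : Module.Basis (Fin q × Fin q) R A)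
    (hB : ∀ i, B i = u ^ (i.1 : ℕ) * v ^ (i.2 : ℕ)) (ha : a ≠ 0)
    (hc : c = algebraMap R A a * v - algebraMap R A b * u) {d r d' r' : R}
    (hu : u ^ q = algebraMap R A d * u + algebraMap R A r)
    (hcq : c ^ q = algebraMap R A d' * c + algebraMap R A r')
    (Λ : Finset R) (hΛ : q ≤ Λ.card) {x : A}
    (hx : ∀ t ∈ Λ, ∃ τ : A →ₐ[R] A, τ u = u + algebraMap R A t ∧ τ c = c ∧ τ x = x) :
    ∃ (N : ℕ) (s : Fin q → R), a ^ N • x = ∑ j, algebraMap R A (s j) * c ^ (j : ℕ) := by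
  have hxm : x ∈ Algebra.adjoin R {u, v} := by
    rw [← B.sum_repr x]
    refine sum_mem fun i _ ↦ Subalgebra.smul_mem _ ?_ _
    rw [hB]
    exact mul_mem (pow_mem (Algebra.subset_adjoin (by simp)) _)
      (pow_mem (Algebra.subset_adjoin (by simp)) _)
  obtain ⟨N, hN⟩ := exists_pow_smul_mem_adjoin hc hxm
  obtain ⟨s, hs⟩ := (Submodule.mem_span_range_iff_exists_fun R).mp (adjoin_le_span hq hu hcq hN)
  have hli := linearIndependent_mul_pow hq B hB ha hc hu hcq
  -- The expansion of `a ^ N • x` is grouped by powers of `c`, with coefficients polynomial in `u`.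
  let S : Fin q → Polynomial R := fun j ↦ ∑ i : Fin q, C (s (i, j)) * X ^ (i : ℕ)
  have hdeg {S : Polynomial R} (hS : S.natDegree < q) (y : A) :
      aeval y S = ∑ i : Fin q, S.coeff i • y ^ (i : ℕ) := by
    rw [aeval_eq_sum_range' hS, Finset.sum_range]
  have hSdeg (j : Fin q) : (S j).natDegree < q := by
    refine lt_of_le_of_lt (b := q - 1) (natDegree_sum_le_of_forall_le _ _ fun i _ ↦ ?_) (by omega)
    exact (natDegree_C_mul_X_pow_le _ _).trans (by omega)
  have haev : a ^ N • x = ∑ j, aeval u (S j) * c ^ (j : ℕ) := by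
    rw [← hs, Fintype.sum_prod_type_right]
    refine Finset.sum_congr rfl fun j _ ↦ ?_
    simp only [S, map_sum, map_mul, aeval_C, map_pow, aeval_X, Finset.sum_mul, Algebra.smul_def,
      mul_assoc]
  have hconst (j : Fin q) : S j = C ((S j).eval 0) := by
    refine eq_C_of_comp_eq (hSdeg j) Λ hΛ fun t ht ↦ ?_
    obtain ⟨τ, hτu, hτc, hτx⟩ := hx t ht
    have hcomp (j : Fin q) : ((S j).comp (X + C t)).natDegree < q := by
      rw [natDegree_comp, natDegree_X_add_C, mul_one]
      exact hSdeg j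
    -- Applying `τ` only replaces `u` by `u + t`. All degrees stay below `q`, so independence of the
    -- `u ^ i * c ^ j` lets the coefficients be compared.
    have h1 : ∑ j, aeval u ((S j).comp (X + C t)) * c ^ (j : ℕ) =
        ∑ j, aeval u (S j) * c ^ (j : ℕ) := by
      rw [← haev]
      conv_rhs => rw [← hτx, ← map_smul, haev, map_sum]
      refine Finset.sum_congr rfl fun j _ ↦ ?_
      rw [map_mul, map_pow, hτc, ← aeval_algHom_apply, hτu, aeval_comp]
      simp
    have h2 : ∑ i : Fin q × Fin q, (((S i.2).comp (X + C t)).coeff i.1 - (S i.2).coeff i.1) •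
        (u ^ (i.1 : ℕ) * c ^ (i.2 : ℕ)) = 0 := by
      rw [Fintype.sum_prod_type_right, ← sub_eq_zero.mpr h1, ← Finset.sum_sub_distrib]
      refine Finset.sum_congr rfl fun j _ ↦ ?_
      rw [hdeg (hcomp j), hdeg (hSdeg j), ← sub_mul, ← Finset.sum_sub_distrib, Finset.sum_mul]
      refine Finset.sum_congr rfl fun i _ ↦ ?_
      rw [← sub_smul, smul_mul_assoc]
    have h3 := Fintype.linearIndependent_iff.mp hli _ h2
    ext i
    rcases Nat.lt_or_ge i q with hi | hi
    · exact sub_eq_zero.mp (h3 (⟨i, hi⟩, j))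
    · rw [coeff_eq_zero_of_natDegree_lt ((hcomp j).trans_le hi),
        coeff_eq_zero_of_natDegree_lt ((hSdeg j).trans_le hi)]
  refine ⟨N, fun j ↦ (S j).eval 0, ?_⟩
  rw [haev]
  refine Finset.sum_congr rfl fun j _ ↦ ?_
  conv_lhs => rw [hconst j, aeval_C]

/-- If a combination of powers of `c = a v - b u` is divisible by `a`, then so are its
coefficients. -/
lemma dvd_of_sum_eq_smul [IsDomain R] (B : Module.Basis (Fin q × Fin q) R A)
    (hB : ∀ i, B i = u ^ (i.1 : ℕ) * v ^ (i.2 : ℕ)) (ha : Prime a) (hab : ¬ a ∣ b)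
    (hc : c = algebraMap R A a * v - algebraMap R A b * u) {s : Fin q → R} {x : A}
    (h : ∑ j, algebraMap R A (s j) * c ^ (j : ℕ) = a • x) (j : Fin q) : a ∣ s j := by
  have hq : 0 < q := j.pos
  have hcu (m : ℕ) : ∃ y, c ^ m = (algebraMap R A (-b) * u) ^ m + algebraMap R A a * y := by
    obtain ⟨y, hy⟩ := sub_dvd_pow_sub_pow c (algebraMap R A (-b) * u) m
    refine ⟨v * y, ?_⟩
    rw [hc, map_neg] at hy ⊢
    linear_combination hy
  choose y hy using hcu
  -- Modulo `a`, the power `c ^ j` becomes `(-b) ^ j * u ^ j`. Distinct `j` meet distinct basis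
  -- vectors, so `a` divides each `s j * (-b) ^ j`.
  have h1 : ∑ j : Fin q, (s j * (-b) ^ (j : ℕ)) • B (j, ⟨0, hq⟩) =
      a • (x - ∑ j : Fin q, s j • y j) := by
    rw [smul_sub, ← h, Finset.smul_sum, ← Finset.sum_sub_distrib]
    refine Finset.sum_congr rfl fun j _ ↦ ?_
    rw [hB, hy]
    simp only [Algebra.smul_def, map_mul, map_pow, pow_zero]
    ring
  have h2 := congrArg (fun z ↦ B.repr z (j, ⟨0, hq⟩)) h1
  simp only [map_sum, map_smul, Module.Basis.repr_self, Finsupp.coe_finsetSum, Finset.sum_apply,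
    Finsupp.smul_apply, smul_eq_mul] at h2
  rw [Finset.sum_eq_single j (fun i _ hi ↦ by simp [hi]) (by simp)] at h2
  have h3 : a ∣ s j * (-b) ^ (j : ℕ) := ⟨_, by simpa using h2⟩
  refine (ha.dvd_or_dvd h3).resolve_right fun h4 ↦ hab ?_
  simpa using ha.dvd_of_dvd_pow h4

/-- An element a multiple of which by a power of `a` is a combination of powers of
`c = a v - b u` is itself such a combination. -/
lemma exists_eq_sum_of_pow_smul [IsDomain R] (B : Module.Basis (Fin q × Fin q) R A)
    (hB : ∀ i, B i = u ^ (i.1 : ℕ) * v ^ (i.2 : ℕ)) (ha : Prime a) (hab : ¬ a ∣ b)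
    (hc : c = algebraMap R A a * v - algebraMap R A b * u) {x : A} (N : ℕ) {s : Fin q → R}
    (h : a ^ N • x = ∑ j, algebraMap R A (s j) * c ^ (j : ℕ)) :
    ∃ s : Fin q → R, x = ∑ j, algebraMap R A (s j) * c ^ (j : ℕ) := by
  have := Module.Free.of_basis B
  induction N generalizing s with
  | zero => exact ⟨s, by simpa using h⟩
  | succ N ih =>
    have hd := dvd_of_sum_eq_smul B hB ha hab hc (s := s) (x := a ^ N • x)
      (by rw [← h, smul_smul, pow_succ'])
    choose s' hs' using hd
    refine ih (s := s') (smul_right_injective A ha.ne_zero ?_)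
    change a • a ^ N • x = a • _
    rw [smul_smul, ← pow_succ', h, Finset.smul_sum]
    refine Finset.sum_congr rfl fun j _ ↦ ?_
    rw [hs', map_mul, Algebra.smul_def, mul_assoc]

end Invariants

/-! ### Series in a subset of the variables, and primality of a variable. -/

section Rename

open MvPowerSeries

variable {σ τ R : Type*}

lemma rename_killCompl [CommSemiring R] (e : σ ↪ τ) {H : MvPowerSeries τ R}
    (h : ∀ d : τ →₀ ℕ, (∃ t ∉ Set.range e, d t ≠ 0) → coeff d H = 0) :
    rename e (killCompl e H) = H := by
  ext d
  by_cases hd : d ∈ Set.range (Finsupp.embDomain e)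
  · obtain ⟨x, rfl⟩ := hd
    rw [coeff_embDomain_rename, coeff_killCompl]
  · rw [coeff_rename_eq_zero, h]
    · rw [Finsupp.mem_range_embDomain_iff, Set.not_subset] at hd
      obtain ⟨t, ht, hte⟩ := hd
      exact ⟨t, hte, by simpa using ht⟩
    · rintro ⟨x, rfl⟩
      exact hd ⟨x, Finsupp.embDomain_eq_mapDomain e x⟩

lemma coeff_rename_eq_zero_of_ne_zero [CommSemiring R] (e : σ ↪ τ) (r : MvPowerSeries σ R)
    {d : τ →₀ ℕ} {t : τ} (ht : t ∉ Set.range e) (hd : d t ≠ 0) : coeff d (rename e r) = 0 := by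
  refine coeff_rename_eq_zero _ _ ?_
  rintro ⟨x, rfl⟩
  rw [Finsupp.mapDomain_of_notMem_range _ _ ht] at hd
  exact hd rfl

lemma coeff_rename_mul_monomial [CommSemiring R] (e : σ ↪ τ) (r : MvPowerSeries σ R)
    {μ : τ →₀ ℕ} (hμ : ∀ i, μ (e i) = 0) (d : τ →₀ ℕ)
    [Decidable (∀ t ∉ Set.range e, d t = μ t)] :
    coeff d (rename e r * monomial μ 1) = if ∀ t ∉ Set.range e, d t = μ t then
      coeff (Finsupp.comapDomain e d e.injective.injOn) r else 0 := by
  classical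
  rw [coeff_mul_monomial, mul_one]
  by_cases h : ∀ t ∉ Set.range e, d t = μ t
  · have hle : μ ≤ d := fun t ↦ by
      by_cases ht : t ∈ Set.range e
      · obtain ⟨i, rfl⟩ := ht
        rw [hμ]
        exact Nat.zero_le _
      · exact (h t ht).ge
    rw [if_pos hle, if_pos h, ← coeff_embDomain_rename e]
    congr 2
    refine Finsupp.ext fun t ↦ ?_
    by_cases ht : t ∈ Set.range e
    · obtain ⟨i, rfl⟩ := ht
      simp [hμ, Finsupp.comapDomain_apply]
    · rw [Finsupp.embDomain_of_notMem_range _ _ _ ht, Finsupp.tsub_apply, h t ht, tsub_self]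
  · rw [if_neg h]
    split_ifs with hle
    · push Not at h
      obtain ⟨t, ht, hne⟩ := h
      refine coeff_rename_eq_zero_of_ne_zero e r ht ?_
      have := hle t
      rw [Finsupp.tsub_apply]
      omega
    · rfl

/-- Divisibility by `X s` means vanishing after setting `X s = 0`, and the series in the remaining
variables form a domain. -/
lemma prime_X [CommRing R] [IsDomain R] (s : σ) : Prime (X s : MvPowerSeries σ R) := by
  have key (φ : MvPowerSeries σ R) :
      X s ∣ φ ↔ killCompl (Function.Embedding.subtype (· ≠ s)) φ = 0 := by
    rw [X_dvd_iff]
    constructor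
    · intro h
      ext x
      rw [coeff_killCompl, map_zero]
      exact h _ (Finsupp.embDomain_of_notMem_range _ _ _ (by simp))
    · intro h d hd
      have hd' : d ∈ Set.range (Finsupp.embDomain (Function.Embedding.subtype (· ≠ s))) := by
        rw [Finsupp.mem_range_embDomain_iff]
        intro t ht
        refine ⟨⟨t, ?_⟩, rfl⟩
        rintro rfl
        simp [hd] at ht
      obtain ⟨x, rfl⟩ := hd'
      rw [← coeff_killCompl, h, map_zero]
  refine ⟨fun h ↦ ?_, fun h ↦ ?_, fun a b h ↦ ?_⟩
  · have := congrArg (coeff (Finsupp.single s 1)) h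
    simp [coeff_index_single_self_X] at this
  · have := h.map (constantCoeff (σ := σ) (R := R))
    simp at this
  · rw [key, map_mul, mul_eq_zero] at h
    rwa [key, key]

lemma not_X_dvd_X [CommRing R] [Nontrivial R] {s t : σ} (h : s ≠ t) :
    ¬ (X s : MvPowerSeries σ R) ∣ X t := by
  classical
  rw [X_dvd_iff]
  intro h'
  have := h' (Finsupp.single t 1) (by simp [h.symm])
  simp [coeff_index_single_self_X] at this

end Rename

/-! ### Lower bounds for weighted orders. -/

section WeightedOrder

open MvPowerSeries

variable {σ R : Type*} [CommRing R] {wt : σ → ℕ} {N : ℕ∞} {x y : MvPowerSeries σ R}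

lemma le_weightedOrder_add' (hx : N ≤ x.weightedOrder wt) (hy : N ≤ y.weightedOrder wt) :
    N ≤ (x + y).weightedOrder wt :=
  (le_min hx hy).trans (min_weightedOrder_le_add wt)

lemma le_weightedOrder_sub (hx : N ≤ x.weightedOrder wt) (hy : N ≤ y.weightedOrder wt) :
    N ≤ (x - y).weightedOrder wt := by
  rw [sub_eq_add_neg]
  exact le_weightedOrder_add' hx (by rwa [weightedOrder_neg])

lemma le_weightedOrder_of_dvd (hx : N ≤ x.weightedOrder wt) (h : x ∣ y) :
    N ≤ y.weightedOrder wt := by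
  obtain ⟨z, rfl⟩ := h
  exact (hx.trans le_self_add).trans (le_weightedOrder_mul wt)

lemma le_weightedOrder_X (s : σ) :
    ((wt s : ℕ) : ℕ∞) ≤ (X s : MvPowerSeries σ R).weightedOrder wt := by
  classical
  refine le_weightedOrder wt fun d hd ↦ ?_
  rw [coeff_X, if_neg]
  rintro rfl
  simp [Finsupp.weight_single] at hd

lemma le_weightedOrder_X_mul_X (s t : σ) :
    ((wt s + wt t : ℕ) : ℕ∞) ≤ (X s * X t : MvPowerSeries σ R).weightedOrder wt := by
  push_cast
  exact (add_le_add (le_weightedOrder_X s) (le_weightedOrder_X t)).trans (le_weightedOrder_mul wt)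

end WeightedOrder

/-! ### Lowest terms of the tail polynomial. -/

section TailPoly

open Polynomial

variable {k : Type*} [Field k] {q : ℕ} (f : Polynomial k)

lemma X_dvd_tailPoly (q : ℕ) : X ∣ tailPoly q f :=
  Finset.dvd_sum fun i _ ↦ Dvd.dvd.mul_left (dvd_pow_self X i.succ_ne_zero) _

/-- The linear coefficient of `tailPoly q f` is `f.coeff (q - 1)`, so the linear terms cancel. -/
lemma X_sq_dvd_tailPoly_sub (hq : 0 < q) (hf : f.coeff (q - 1) = 1) :
    X * X ∣ X - tailPoly q f := by
  obtain ⟨m, rfl⟩ : ∃ m, q = m + 1 := ⟨q - 1, by omega⟩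
  rw [tailPoly, Finset.sum_range_succ']
  simp only [add_tsub_cancel_right, tsub_zero] at hf ⊢
  rw [hf, C_1, one_mul, zero_add, pow_one, sub_add_cancel_right]
  refine (dvd_neg.mpr <| Finset.dvd_sum fun i _ ↦ Dvd.dvd.mul_left ?_ _)
  rw [← sq]
  exact pow_dvd_pow X (by omega)

variable {B : Type*} [CommRing B] [Algebra k B]

lemma dvd_aeval_tailPoly (q : ℕ) (w : B) : w ∣ aeval w (tailPoly q f) := by
  simpa using map_dvd (aeval w) (X_dvd_tailPoly f q)

lemma mul_self_dvd_sub_aeval_tailPoly (hq : 0 < q) (hf : f.coeff (q - 1) = 1) (w : B) :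
    w * w ∣ w - aeval w (tailPoly q f) := by
  simpa using map_dvd (aeval w) (X_sq_dvd_tailPoly_sub f hq hf)

end TailPoly

/-! ### The curve equation as a Weierstrass divisor, in `u` or in `w`. -/

section CurveEq

open MvPowerSeries

variable {k : Type*} [Field k] {q : ℕ} (f : Polynomial k) {σ : Type*}

/-- The power series `V` with `u ^ q - u w ^ (q - 1) - P(w) = u ^ q - V`. -/
noncomputable def curveRestU (q : ℕ) (s t : σ) : MvPowerSeries σ k :=
  X s * X t ^ (q - 1) + Polynomial.aeval (X t) (tailPoly q f)

/-- The power series `V` with `u ^ q - u w ^ (q - 1) - P(w) = -(w - V)`. -/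
noncomputable def curveRestW (q : ℕ) (s t : σ) : MvPowerSeries σ k :=
  (X t - Polynomial.aeval (X t) (tailPoly q f)) - X s * X t ^ (q - 1) + X s ^ q

lemma curveEq_eq_sub_curveRestU (s t : σ) :
    curveEq q f (X s : MvPowerSeries σ k) (X t) = X s ^ q - curveRestU f q s t := by
  rw [curveEq, curveRestU]
  ring

lemma curveEq_eq_neg_sub_curveRestW (s t : σ) :
    curveEq q f (X s : MvPowerSeries σ k) (X t) = -(X t ^ 1 - curveRestW f q s t) := by
  rw [curveEq, curveRestW]
  ring

lemma le_weightedOrder_curveRestU (hq : 2 ≤ q) {wt : σ → ℕ} {s t : σ} (hs : wt s = 0)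
    (ht : wt t = 1) :
    ((q * wt s + 1 : ℕ) : ℕ∞) ≤ (curveRestU f q s t).weightedOrder wt := by
  rw [hs, mul_zero, zero_add, ← ht]
  exact le_weightedOrder_of_dvd (le_weightedOrder_X t)
    (dvd_add (Dvd.dvd.mul_left (dvd_pow_self _ (by omega)) _) (dvd_aeval_tailPoly f q _))

lemma le_weightedOrder_curveRestW (hq : 2 ≤ q) (hf : f.coeff (q - 1) = 1) {wt : σ → ℕ} {s t : σ}
    (hs : wt s = 1) (ht : wt t = 1) :
    ((1 * wt t + 1 : ℕ) : ℕ∞) ≤ (curveRestW f q s t).weightedOrder wt := by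
  have h2 (i j : σ) (hi : wt i = 1) (hj : wt j = 1) :
      ((1 * wt t + 1 : ℕ) : ℕ∞) ≤ (X i * X j : MvPowerSeries σ k).weightedOrder wt := by
    have := le_weightedOrder_X_mul_X (R := k) (wt := wt) i j
    rw [ht]
    rwa [hi, hj] at this
  rw [curveRestW]
  refine le_weightedOrder_add' (le_weightedOrder_sub ?_ ?_) ?_
  · exact le_weightedOrder_of_dvd (h2 t t ht ht)
      (mul_self_dvd_sub_aeval_tailPoly f (by omega) hf _)
  · exact le_weightedOrder_of_dvd (h2 s t hs ht) (mul_dvd_mul_left _ (dvd_pow_self _ (by omega)))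
  · exact le_weightedOrder_of_dvd (h2 s s hs hs) (by rw [← sq]; exact pow_dvd_pow _ hq)

end CurveEq

/-! ### Elimination of `w` and `w'` from `A`. -/

section ProductRing

open MvPowerSeries

variable {k : Type*} [Field k] {q : ℕ} (f g : Polynomial k)

lemma productIdeal_eq_span_curveRestU : productIdeal q f g =
    Ideal.span {X 0 ^ q - curveRestU f q 0 1, X 2 ^ q - curveRestU g q 2 3} := by
  rw [productIdeal, curveEq_eq_sub_curveRestU, curveEq_eq_sub_curveRestU]

lemma productIdeal_eq_span_curveRestW : productIdeal q f g =
    Ideal.span {X 1 ^ 1 - curveRestW f q 0 1, X 3 ^ 1 - curveRestW g q 2 3} := by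
  rw [productIdeal, curveEq_eq_neg_sub_curveRestW, curveEq_eq_neg_sub_curveRestW,
    Ideal.span_insert, Ideal.span_insert, Ideal.span_singleton_neg, Ideal.span_singleton_neg]

/-- The embedding of `Fin 2` with values `i`, `j`. -/
def pairEmbedding {n : ℕ} (i j : Fin n) (h : i ≠ j) : Fin 2 ↪ Fin n where
  toFun := ![i, j]
  inj' x y hxy := by
    fin_cases x <;> fin_cases y <;> simp_all [eq_comm]

@[simp]
lemma pairEmbedding_zero {n : ℕ} {i j : Fin n} (h : i ≠ j) : pairEmbedding i j h 0 = i := rfl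

@[simp]
lemma pairEmbedding_one {n : ℕ} {i j : Fin n} (h : i ≠ j) : pairEmbedding i j h 1 = j := rfl

lemma mem_range_pairEmbedding {n : ℕ} {i j : Fin n} (h : i ≠ j) (t : Fin n) :
    t ∈ Set.range (pairEmbedding i j h) ↔ t = i ∨ t = j := by
  rw [Set.mem_range, Fin.exists_fin_two]
  exact or_congr eq_comm eq_comm

/-- The power series in `u, u'`, as power series in `u, w, u', w'`. -/
abbrev coordinateEmbedding : Fin 2 ↪ Fin 4 := pairEmbedding 0 2 (by decide)

/-- The power series in `w, w'`, as power series in `u, w, u', w'`. -/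
abbrev baseEmbedding : Fin 2 ↪ Fin 4 := pairEmbedding 1 3 (by decide)

lemma coordinateMap_apply (x : MvPowerSeries (Fin 2) k) :
    coordinateMap q f g x = Ideal.Quotient.mk _ (rename coordinateEmbedding x) := by
  rw [rename_eq_subst]
  have h : (![X 0, X 2] : Fin 2 → Series4 k) = X ∘ coordinateEmbedding := by
    funext i
    fin_cases i <;> rfl
  rw [← h, ← substAlgHom_apply (R := k) HasSubst.X_X]
  rfl

theorem coordinateMap_bijective (hq : 2 ≤ q) (hf : f.coeff (q - 1) = 1)
    (hg : g.coeff (q - 1) = 1) : Function.Bijective (coordinateMap q f g) := by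
  -- With all weights 1 the divisors are `w - V` and `w' - V'`, where `V`, `V'` have order at least
  -- 2. Remainders are exactly the series in `u`, `u'`.
  have hV := le_weightedOrder_curveRestW f hq hf (wt := fun _ : Fin 4 ↦ 1) (s := 0) (t := 1) rfl rfl
  have hV' := le_weightedOrder_curveRestW g hq hg (wt := fun _ : Fin 4 ↦ 1) (s := 2) (t := 3)
    rfl rfl
  constructor
  · rw [injective_iff_map_eq_zero]
    intro x hx
    rw [coordinateMap_apply, Ideal.Quotient.eq_zero_iff_mem, productIdeal_eq_span_curveRestW] at hx
    have h := eq_zero_of_mem_span _ 1 (by decide) hV hV' (fun e he ↦ ?_) hx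
    · exact rename_injective coordinateEmbedding (h.trans (map_zero _).symm)
    · rcases he with he | he
      · exact coeff_rename_eq_zero_of_ne_zero _ _ (t := 1)
          (by rw [mem_range_pairEmbedding]; decide) (by omega)
      · exact coeff_rename_eq_zero_of_ne_zero _ _ (t := 3)
          (by rw [mem_range_pairEmbedding]; decide) (by omega)
  · intro y
    obtain ⟨G, rfl⟩ := Ideal.Quotient.mk_surjective y
    obtain ⟨H, K, L, hH, rfl⟩ := exists_division₂ _ 1 3 1 hV hV' G
    refine ⟨killCompl coordinateEmbedding H, ?_⟩
    rw [coordinateMap_apply, rename_killCompl, Ideal.Quotient.mk_eq_mk_iff_sub_mem,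
      productIdeal_eq_span_curveRestW, Ideal.mem_span_pair]
    · exact ⟨-K, -L, by ring⟩
    · rintro d ⟨t, ht, hd⟩
      rw [mem_range_pairEmbedding] at ht
      apply hH
      fin_cases t
      · simp at ht
      · left; exact Nat.one_le_iff_ne_zero.mpr hd
      · simp at ht
      · right; exact Nat.one_le_iff_ne_zero.mpr hd

end ProductRing

/-! ### Freeness of `A` over `k[[w, w']]`. -/

section ProductBasis

open MvPowerSeries

variable {k : Type*} [Field k] {q : ℕ} (f g : Polynomial k)

/-- `A` as an algebra over `k[[w, w']]`. -/
noncomputable abbrev baseAlgebra (q : ℕ) (f g : Polynomial k) :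
    Algebra (MvPowerSeries (Fin 2) k) (ProductRing q f g) :=
  ((Ideal.Quotient.mk (productIdeal q f g)).comp (rename (R := k) baseEmbedding).toRingHom).toAlgebra

attribute [local instance] baseAlgebra

lemma baseAlgebraMap_apply (r : MvPowerSeries (Fin 2) k) :
    algebraMap (MvPowerSeries (Fin 2) k) (ProductRing q f g) r =
      Ideal.Quotient.mk _ (rename baseEmbedding r) := rfl

lemma baseAlgebraMap_X_zero :
    algebraMap (MvPowerSeries (Fin 2) k) (ProductRing q f g) (X 0) =
      Ideal.Quotient.mk _ (X 1) := by
  rw [baseAlgebraMap_apply, rename_X]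
  rfl

lemma baseAlgebraMap_X_one :
    algebraMap (MvPowerSeries (Fin 2) k) (ProductRing q f g) (X 1) =
      Ideal.Quotient.mk _ (X 3) := by
  rw [baseAlgebraMap_apply, rename_X]
  rfl

lemma baseAlgebraMap_C (d : k) :
    algebraMap (MvPowerSeries (Fin 2) k) (ProductRing q f g) (C d) =
      Ideal.Quotient.mk _ (C d) := by
  rw [baseAlgebraMap_apply, rename_C]

/-- The exponent of the monomial `u ^ i * u' ^ j`. -/
noncomputable abbrev coordinateExponent (i j : ℕ) : Fin 4 →₀ ℕ :=
  Finsupp.single 0 i + Finsupp.single 2 j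

lemma X_pow_mul_X_pow_eq_monomial (i j : ℕ) :
    (X 0 ^ i * X 2 ^ j : Series4 k) = monomial (coordinateExponent i j) 1 := by
  rw [X_pow_eq, X_pow_eq, monomial_mul_monomial, one_mul]

lemma coeff_rename_mul_X_pow (r : MvPowerSeries (Fin 2) k) (i j : ℕ) (d : Fin 4 →₀ ℕ) :
    coeff d (rename baseEmbedding r * (X 0 ^ i * X 2 ^ j)) = if d 0 = i ∧ d 2 = j then
      coeff (Finsupp.comapDomain baseEmbedding d baseEmbedding.injective.injOn) r else 0 := by
  classical
  rw [X_pow_mul_X_pow_eq_monomial, coeff_rename_mul_monomial]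
  · refine if_congr ?_ rfl rfl
    simp only [mem_range_pairEmbedding]
    rw [Fin.forall_fin_succ, Fin.forall_fin_succ, Fin.forall_fin_two]
    simp
  · intro t
    fin_cases t <;> simp

lemma sum_rename_mul_X_pow_coeff (r : Fin q × Fin q → MvPowerSeries (Fin 2) k) (d : Fin 4 →₀ ℕ) :
    coeff d (∑ i, rename baseEmbedding (r i) * (X 0 ^ (i.1 : ℕ) * X 2 ^ (i.2 : ℕ))) =
      if h : d 0 < q ∧ d 2 < q then
        coeff (Finsupp.comapDomain baseEmbedding d baseEmbedding.injective.injOn)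
          (r (⟨d 0, h.1⟩, ⟨d 2, h.2⟩)) else 0 := by
  simp only [map_sum, coeff_rename_mul_X_pow]
  split_ifs with h
  · rw [Finset.sum_eq_single (⟨d 0, h.1⟩, ⟨d 2, h.2⟩)]
    · simp
    · rintro ⟨i, j⟩ - hne
      rw [if_neg]
      rintro ⟨h1, h2⟩
      exact hne (Prod.ext (Fin.ext h1.symm) (Fin.ext h2.symm))
    · simp
  · refine Finset.sum_eq_zero fun i _ ↦ if_neg ?_
    rintro ⟨h1, h2⟩
    exact h ⟨h1 ▸ i.1.2, h2 ▸ i.2.2⟩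

variable (q) in
/-- The family `u ^ i * u' ^ j`, `i, j < q`, in `A`. -/
noncomputable def coordinateMonomials (i : Fin q × Fin q) : ProductRing q f g :=
  Ideal.Quotient.mk _ (X 0) ^ (i.1 : ℕ) * Ideal.Quotient.mk _ (X 2) ^ (i.2 : ℕ)

lemma sum_smul_coordinateMonomials (r : Fin q × Fin q → MvPowerSeries (Fin 2) k) :
    ∑ i, r i • coordinateMonomials q f g i = Ideal.Quotient.mk _
      (∑ i, rename baseEmbedding (r i) * (X 0 ^ (i.1 : ℕ) * X 2 ^ (i.2 : ℕ))) := by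
  rw [map_sum]
  refine Finset.sum_congr rfl fun i _ ↦ ?_
  rw [Algebra.smul_def, baseAlgebraMap_apply, coordinateMonomials, map_mul, map_mul, map_pow,
    map_pow]

lemma linearIndependent_coordinateMonomials (hq : 2 ≤ q) :
    LinearIndependent (MvPowerSeries (Fin 2) k) (coordinateMonomials q f g) := by
  rw [Fintype.linearIndependent_iff]
  intro r hr
  rw [sum_smul_coordinateMonomials, Ideal.Quotient.eq_zero_iff_mem,
    productIdeal_eq_span_curveRestU] at hr
  -- Weight 0 for `u`, `u'` gives their `q`-th powers weight 0, while the rest of each equation is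
  -- divisible by `w` or `w'`, of weight 1.
  have h := eq_zero_of_mem_span (wt := ![0, 1, 0, 1]) q (by decide)
    (le_weightedOrder_curveRestU f hq rfl rfl) (le_weightedOrder_curveRestU g hq rfl rfl)
    (fun e he ↦ by rw [sum_rename_mul_X_pow_coeff, dif_neg (by omega)]) hr
  rintro ⟨i, j⟩
  ext x
  -- This exponent isolates the coefficient of `r (i, j)` at `x`.
  have h' := congrArg (coeff (Finsupp.embDomain baseEmbedding x + coordinateExponent i j)) h
  have h0 : (Finsupp.embDomain baseEmbedding x + coordinateExponent i j) 0 = i := by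
    rw [Finsupp.add_apply, Finsupp.embDomain_of_notMem_range _ _ _
      (by rw [mem_range_pairEmbedding]; decide)]
    simp
  have h2 : (Finsupp.embDomain baseEmbedding x + coordinateExponent i j) 2 = j := by
    rw [Finsupp.add_apply, Finsupp.embDomain_of_notMem_range _ _ _
      (by rw [mem_range_pairEmbedding]; decide)]
    simp
  have hx : Finsupp.comapDomain baseEmbedding
      (Finsupp.embDomain baseEmbedding x + coordinateExponent i j)
      baseEmbedding.injective.injOn = x := by
    ext t
    rw [Finsupp.comapDomain_apply, Finsupp.add_apply, Finsupp.embDomain_apply_self]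
    fin_cases t <;> simp
  rw [sum_rename_mul_X_pow_coeff, dif_pos (by rw [h0, h2]; exact ⟨i.2, j.2⟩)] at h'
  simpa only [h0, h2, hx, Fin.eta, map_zero] using h'

lemma span_coordinateMonomials (hq : 2 ≤ q) :
    ⊤ ≤ Submodule.span (MvPowerSeries (Fin 2) k) (Set.range (coordinateMonomials q f g)) := by
  rintro y -
  obtain ⟨G, rfl⟩ := Ideal.Quotient.mk_surjective y
  obtain ⟨H, K, L, hH, rfl⟩ := exists_division₂ (wt := ![0, 1, 0, 1]) 0 2 q
    (le_weightedOrder_curveRestU f hq (s := 0) (t := 1) rfl rfl)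
    (le_weightedOrder_curveRestU g hq (s := 2) (t := 3) rfl rfl) G
  rw [Submodule.mem_span_range_iff_exists_fun]
  let r (i : Fin q × Fin q) : MvPowerSeries (Fin 2) k := fun x ↦
    coeff (Finsupp.embDomain baseEmbedding x + coordinateExponent i.1 i.2) H
  refine ⟨r, ?_⟩
  have hr : ∑ i, rename baseEmbedding (r i) * (X 0 ^ (i.1 : ℕ) * X 2 ^ (i.2 : ℕ)) = H := by
    ext d
    rw [sum_rename_mul_X_pow_coeff]
    split_ifs with h
    · change coeff (Finsupp.embDomain _ _ + coordinateExponent (d 0) (d 2)) H = coeff d H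
      congr 2
      refine Finsupp.ext fun t ↦ ?_
      rw [Finsupp.add_apply]
      fin_cases t
      · rw [Finsupp.embDomain_of_notMem_range _ _ _ (by rw [mem_range_pairEmbedding]; decide)]
        simp
      · exact (congrArg₂ _ (Finsupp.embDomain_apply_self baseEmbedding _ 0) rfl).trans
          (by simp [Finsupp.comapDomain_apply])
      · rw [Finsupp.embDomain_of_notMem_range _ _ _ (by rw [mem_range_pairEmbedding]; decide)]
        simp
      · exact (congrArg₂ _ (Finsupp.embDomain_apply_self baseEmbedding _ 1) rfl).trans
          (by simp [Finsupp.comapDomain_apply])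
    · exact (hH d (by omega)).symm
  rw [sum_smul_coordinateMonomials, hr, Ideal.Quotient.mk_eq_mk_iff_sub_mem,
    productIdeal_eq_span_curveRestU, Ideal.mem_span_pair]
  exact ⟨-K, -L, by ring⟩

/-- The basis `u ^ i * u' ^ j`, `i, j < q`, of `A` over `k[[w, w']]`. -/
noncomputable def productBasis (hq : 2 ≤ q) :
    Module.Basis (Fin q × Fin q) (MvPowerSeries (Fin 2) k) (ProductRing q f g) :=
  Module.Basis.mk (linearIndependent_coordinateMonomials f g hq) (span_coordinateMonomials f g hq)

lemma productBasis_apply (hq : 2 ≤ q) (i : Fin q × Fin q) : productBasis f g hq i =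
    (Ideal.Quotient.mk (productIdeal q f g) (X 0)) ^ (i.1 : ℕ) *
      (Ideal.Quotient.mk (productIdeal q f g) (X 2)) ^ (i.2 : ℕ) := by
  rw [productBasis, Module.Basis.mk_apply, coordinateMonomials]

lemma baseAlgebraMap_aeval (t : Fin 2) (P : Polynomial k) :
    algebraMap (MvPowerSeries (Fin 2) k) (ProductRing q f g) (Polynomial.aeval (X t) P) =
      Ideal.Quotient.mk _ (Polynomial.aeval (X (baseEmbedding t)) P) := by
  rw [baseAlgebraMap_apply, ← Polynomial.aeval_algHom_apply, rename_X]

lemma coordinate_pow : (Ideal.Quotient.mk (productIdeal q f g) (X 0)) ^ q =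
    algebraMap (MvPowerSeries (Fin 2) k) _ (X 0 ^ (q - 1)) * Ideal.Quotient.mk _ (X 0) +
      algebraMap (MvPowerSeries (Fin 2) k) _ (Polynomial.aeval (X 0) (tailPoly q f)) := by
  rw [map_pow, baseAlgebraMap_X_zero, baseAlgebraMap_aeval, ← map_pow, ← map_pow, ← map_mul,
    ← map_add, Ideal.Quotient.mk_eq_mk_iff_sub_mem]
  have h : curveEq q f (X 0 : Series4 k) (X 1) ∈ productIdeal q f g :=
    Ideal.subset_span (Or.inl rfl)
  convert h using 1
  rw [curveEq, show baseEmbedding 0 = 1 from rfl]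
  ring

/-- The element `w u' - w' u` of `A`. -/
noncomputable def invariantElt (q : ℕ) (f g : Polynomial k) : ProductRing q f g :=
  Ideal.Quotient.mk _ (X 1 * X 2 - X 3 * X 0)

lemma invariantElt_eq : invariantElt q f g =
    algebraMap (MvPowerSeries (Fin 2) k) _ (X 0) * Ideal.Quotient.mk _ (X 2) -
      algebraMap (MvPowerSeries (Fin 2) k) _ (X 1) * Ideal.Quotient.mk _ (X 0) := by
  rw [invariantElt, baseAlgebraMap_X_zero, baseAlgebraMap_X_one, map_sub, map_mul, map_mul]

end ProductBasis

/-! ### The invariant ring and the surface ring. -/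

section InvariantMap

open MvPowerSeries

attribute [local instance] baseAlgebra

variable {k : Type*} [Field k] {p : ℕ} [Fact p.Prime] [CharP k p] {n : ℕ} (f g : Polynomial k)

/-- The power series in `a, b`, as power series in `a, b, c`. -/
abbrev surfaceEmbedding : Fin 2 ↪ Fin 3 := pairEmbedding 0 1 (by decide)

lemma invariantSubst_X (i : Fin 3) : invariantSubst k (X i) = invariantVec k i :=
  substAlgHom_X _ i

lemma invariantSubst_rename (r : MvPowerSeries (Fin 2) k) :
    invariantSubst k (rename surfaceEmbedding r) = rename baseEmbedding r := by
  rw [rename_eq_subst, rename_eq_subst, invariantSubst, substAlgHom_apply,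
    subst_comp_subst_apply (HasSubst.X_comp _) (hasSubst_invariantVec k)]
  congr 1
  funext i
  rw [Function.comp_apply, subst_X (hasSubst_invariantVec k)]
  fin_cases i <;> rfl

lemma shift_rename (c : k) (r : MvPowerSeries (Fin 2) k) :
    shift c (rename baseEmbedding r) = rename baseEmbedding r := by
  rw [← invariantSubst_rename, shift_invariantSubst]

lemma coe_invariantMap_mk (x : MvPowerSeries (Fin 3) k) :
    (invariantMap p n f g (Ideal.Quotient.mk _ x) : ProductRing (p ^ n) f g) =
      Ideal.Quotient.mk _ (invariantSubst k x) := rfl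

lemma coe_invariantMap_sum (s : Fin (p ^ n) → MvPowerSeries (Fin 2) k) :
    (invariantMap p n f g (Ideal.Quotient.mk _
      (∑ j, rename surfaceEmbedding (s j) * X 2 ^ (j : ℕ))) : ProductRing (p ^ n) f g) =
      ∑ j, algebraMap _ (ProductRing (p ^ n) f g) (s j) * invariantElt (p ^ n) f g ^ (j : ℕ) := by
  rw [coe_invariantMap_mk, map_sum, map_sum]
  refine Finset.sum_congr rfl fun j _ ↦ ?_
  rw [map_mul, map_pow, invariantSubst_rename, invariantSubst_X, map_mul, map_pow]
  rfl

lemma invariantElt_pow : invariantElt (p ^ n) f g ^ p ^ n =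
    algebraMap (MvPowerSeries (Fin 2) k) _ ((X 0 * X 1) ^ (p ^ n - 1)) * invariantElt (p ^ n) f g +
      algebraMap (MvPowerSeries (Fin 2) k) _
        (X 0 ^ p ^ n * Polynomial.aeval (X 1) (tailPoly (p ^ n) g) -
          X 1 ^ p ^ n * Polynomial.aeval (X 0) (tailPoly (p ^ n) f)) := by
  have h := invariantSubst_surfaceEq (p := p) (n := n) f g
  rw [map_surfaceEq, invariantSubst_X, invariantSubst_X, invariantSubst_X] at h
  rw [map_sub, map_mul, map_mul, map_pow, map_pow, map_pow, map_mul, baseAlgebraMap_aeval,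
    baseAlgebraMap_aeval, baseAlgebraMap_X_zero, baseAlgebraMap_X_one, invariantElt]
  simp only [← map_pow, ← map_mul, ← map_add, ← map_sub]
  rw [Ideal.Quotient.mk_eq_mk_iff_sub_mem]
  convert h using 1
  rw [surfaceEq, show baseEmbedding 0 = 1 from rfl, show baseEmbedding 1 = 3 from rfl]
  simp only [invariantVec, Matrix.cons_val]
  ring

/-- The action of a scalar on `A` is `k[[w, w']]`-linear. -/
noncomputable def baseActionHom (c : scalarGroup k p n) :
    ProductRing (p ^ n) f g →ₐ[MvPowerSeries (Fin 2) k] ProductRing (p ^ n) f g where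
  __ := (actionHom f g c).toRingHom
  commutes' r := by
    change Ideal.Quotient.mk _ (shift (c : k) (rename baseEmbedding r)) = _
    rw [shift_rename]
    rfl

lemma baseActionHom_mk (c : scalarGroup k p n) (x : Series4 k) :
    baseActionHom f g c (Ideal.Quotient.mk _ x) = Ideal.Quotient.mk _ (shift (c : k) x) := rfl

lemma baseActionHom_invariantElt (c : scalarGroup k p n) :
    baseActionHom f g c (invariantElt (p ^ n) f g) = invariantElt (p ^ n) f g := by
  have h : (X 1 * X 2 - X 3 * X 0 : Series4 k) = invariantSubst k (X 2) := by
    rw [invariantSubst_X]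
    rfl
  rw [invariantElt, baseActionHom_mk, h, shift_invariantSubst]

/-- `X ^ q - X` is separable and splits over an algebraically closed field. -/
lemma exists_finset_scalarGroup [IsAlgClosed k] (hn : 1 ≤ n) :
    ∃ Z : Finset k, Z.card = p ^ n ∧ ∀ c ∈ Z, c ^ p ^ n = c := by
  classical
  have hp : 1 < p := (Fact.out : p.Prime).one_lt
  have hsep := galois_poly_separable (K := k) p (p ^ n) (dvd_pow_self p (by omega))
  refine ⟨(Polynomial.X ^ p ^ n - Polynomial.X : Polynomial k).roots.toFinset, ?_, fun c hc ↦ ?_⟩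
  · rw [Multiset.toFinset_card_of_nodup (Polynomial.nodup_roots hsep),
      ← (IsAlgClosed.splits _).natDegree_eq_card_roots,
      FiniteField.X_pow_card_pow_sub_X_natDegree_eq k (by omega) hp]
  · have := Polynomial.isRoot_of_mem_roots (Multiset.mem_toFinset.mp hc)
    simpa [sub_eq_zero] using this

lemma exists_eq_sum_of_mem_invariantRing [IsAlgClosed k] (hn : 1 ≤ n)
    {x : ProductRing (p ^ n) f g} (hx : x ∈ invariantRing p n f g) :
    ∃ s : Fin (p ^ n) → MvPowerSeries (Fin 2) k, x =
      ∑ j, algebraMap _ (ProductRing (p ^ n) f g) (s j) * invariantElt (p ^ n) f g ^ (j : ℕ) := by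
  classical
  have : IsDomain (MvPowerSeries (Fin 2) k) := NoZeroDivisors.to_isDomain _
  have hq : 2 ≤ p ^ n := (Fact.out : p.Prime).two_le.trans (Nat.le_self_pow (by omega) p)
  obtain ⟨Z, hZ, hZq⟩ := exists_finset_scalarGroup (k := k) (p := p) hn
  -- The translations of `u` are by `c * w`, and distinct scalars must give distinct translations
  -- for the root count.
  have hinj : Function.Injective fun c : k ↦ (C c * X 0 : MvPowerSeries (Fin 2) k) := fun c d h ↦
    C_injective (mul_right_cancel₀ (prime_X 0).ne_zero h)
  obtain ⟨N, s, hs⟩ := exists_pow_smul_eq_sum hq (productBasis f g hq) (productBasis_apply f g hq)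
    (prime_X (R := k) (0 : Fin 2)).ne_zero (invariantElt_eq f g) (coordinate_pow f g)
    (invariantElt_pow f g) (Z.image fun c : k ↦ (C c * X 0 : MvPowerSeries (Fin 2) k))
    (by rw [Finset.card_image_of_injective _ hinj, hZ]) (x := x) (fun t ht ↦ by
      obtain ⟨c, hc, rfl⟩ := Finset.mem_image.mp ht
      refine ⟨baseActionHom f g ⟨c, hZq c hc⟩, ?_, baseActionHom_invariantElt f g _,
        hx (Multiplicative.ofAdd ⟨c, hZq c hc⟩)⟩
      rw [baseActionHom_mk, shift_X, map_mul, baseAlgebraMap_X_zero, baseAlgebraMap_C, ← map_mul,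
        ← map_add]
      rfl)
  exact exists_eq_sum_of_pow_smul (productBasis f g hq) (productBasis_apply f g hq) (prime_X 0)
    (not_X_dvd_X (by decide)) (invariantElt_eq f g) N hs

/-- This is Weierstrass division in the third variable; the remainder has degree below `q` in it. -/
lemma exists_surfaceRing_eq_sum {q : ℕ} (hq : 2 ≤ q) (y : SurfaceRing q f g) :
    ∃ s : Fin q → MvPowerSeries (Fin 2) k,
      y = Ideal.Quotient.mk _ (∑ j, rename surfaceEmbedding (s j) * X 2 ^ (j : ℕ)) := by
  classical
  obtain ⟨G, rfl⟩ := Ideal.Quotient.mk_surjective y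
  set V : MvPowerSeries (Fin 3) k := (X 0 * X 1) ^ (q - 1) * X 2 +
    X 0 ^ q * Polynomial.aeval (X 1) (tailPoly q g) -
      X 1 ^ q * Polynomial.aeval (X 0) (tailPoly q f) with hV
  have hS : surfaceEq q f g (X 0 : MvPowerSeries (Fin 3) k) (X 1) (X 2) = X 2 ^ q - V := by
    rw [surfaceEq, hV]
    ring
  -- The first variable divides every term of `V`, the last one because `P` has no constant term;
  -- this gives weight 1 against weight 0 for `X 2 ^ q`.
  have hdvd : (X 0 : MvPowerSeries (Fin 3) k) ∣ V :=
    dvd_sub (dvd_add (((dvd_mul_right _ _).trans (dvd_pow_self _ (by omega))).mul_right _)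
      ((dvd_pow_self _ (by omega)).mul_right _)) ((dvd_aeval_tailPoly f q _).mul_left _)
  obtain ⟨H, K, hH, rfl⟩ := exists_division (wt := (![1, 1, 0] : Fin 3 → ℕ)) 2 q (V := V)
    (by simpa using le_weightedOrder_of_dvd (le_weightedOrder_X (wt := ![1, 1, 0]) 0) hdvd) G
  let s (j : Fin q) : MvPowerSeries (Fin 2) k := fun x ↦
    coeff (Finsupp.embDomain surfaceEmbedding x + Finsupp.single 2 (j : ℕ)) H
  have hs : ∑ j, rename surfaceEmbedding (s j) * X 2 ^ (j : ℕ) = H := by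
    ext d
    have hterm (j : Fin q) : coeff d (rename surfaceEmbedding (s j) * X 2 ^ (j : ℕ)) =
        if d 2 = j then coeff d H else 0 := by
      rw [X_pow_eq, coeff_rename_mul_monomial]
      · have hiff : (∀ t ∉ Set.range surfaceEmbedding, d t = Finsupp.single (2 : Fin 3) (j : ℕ) t) ↔
            d 2 = j := by
          simp only [mem_range_pairEmbedding]
          rw [Fin.forall_fin_succ, Fin.forall_fin_two]
          simp
        refine ite_congr (propext hiff) (fun h ↦ ?_) fun _ ↦ rfl
        change coeff (Finsupp.embDomain _ _ + _) H = coeff d H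
        congr 2
        refine Finsupp.ext fun t ↦ ?_
        rw [Finsupp.add_apply]
        fin_cases t
        · exact (congrArg₂ _ (Finsupp.embDomain_apply_self surfaceEmbedding _ 0) rfl).trans
            (by simp [Finsupp.comapDomain_apply])
        · exact (congrArg₂ _ (Finsupp.embDomain_apply_self surfaceEmbedding _ 1) rfl).trans
            (by simp [Finsupp.comapDomain_apply])
        · rw [Finsupp.embDomain_of_notMem_range _ _ _ (by rw [mem_range_pairEmbedding]; decide)]
          simpa using h.symm
      · intro t
        fin_cases t <;> simp
    rw [map_sum]
    simp only [hterm]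
    by_cases h : d 2 < q
    · rw [Finset.sum_eq_single ⟨d 2, h⟩]
      · simp
      · intro j _ hj
        rw [if_neg]
        intro h'
        exact hj (Fin.ext h'.symm)
      · simp
    · rw [hH d (not_lt.mp h)]
      simp
  refine ⟨s, ?_⟩
  rw [hs, Ideal.Quotient.mk_eq_mk_iff_sub_mem, Ideal.mem_span_singleton, hS]
  exact ⟨K, by ring⟩

theorem invariantMap_bijective [IsAlgClosed k] (hn : 1 ≤ n) :
    Function.Bijective (invariantMap p n f g) := by
  have : IsDomain (MvPowerSeries (Fin 2) k) := NoZeroDivisors.to_isDomain _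
  have hq : 2 ≤ p ^ n := (Fact.out : p.Prime).two_le.trans (Nat.le_self_pow (by omega) p)
  constructor
  · rw [injective_iff_map_eq_zero]
    intro y hy
    obtain ⟨s, rfl⟩ := exists_surfaceRing_eq_sum f g hq y
    have hli := linearIndependent_mul_pow hq (productBasis f g hq) (productBasis_apply f g hq)
      (prime_X (R := k) (0 : Fin 2)).ne_zero (invariantElt_eq f g) (coordinate_pow f g)
      (invariantElt_pow f g)
    -- The products with `i = 0` are the powers of the invariant element alone.
    have hli' := hli.comp (fun j : Fin (p ^ n) ↦ ((⟨0, by omega⟩ : Fin (p ^ n)), j))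
      (fun i j h ↦ (Prod.ext_iff.mp h).2)
    have h := (coe_invariantMap_sum f g s).symm.trans (congrArg Subtype.val hy)
    have hs := Fintype.linearIndependent_iff.mp hli' s (by
      refine Eq.trans (Finset.sum_congr rfl fun j _ ↦ ?_) h
      simp [Algebra.smul_def])
    simp [hs]
  · rintro ⟨x, hx⟩
    obtain ⟨s, hs⟩ := exists_eq_sum_of_mem_invariantRing f g hn hx
    exact ⟨_, Subtype.ext ((coe_invariantMap_sum f g s).trans hs.symm)⟩

end InvariantMap

end ArtinSchreierProduct

theorem mainTheorem11 {k : Type*} [Field k] [IsAlgClosed k] (p : ℕ) [Fact p.Prime] [CharP k p]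
    (n : ℕ) (hn : 1 ≤ n) (f g : Polynomial k) (hf : f.Monic) (hf' : f.natDegree = p ^ n - 1)
    (hg : g.Monic) (hg' : g.natDegree = p ^ n - 1) :
    Function.Bijective (ArtinSchreierProduct.coordinateMap (p ^ n) f g) ∧
      Function.Bijective (ArtinSchreierProduct.invariantMap p n f g) :=
  ⟨ArtinSchreierProduct.coordinateMap_bijective f g
    ((Fact.out : p.Prime).two_le.trans (Nat.le_self_pow (by omega) p))
    (by rw [← hf']; exact hf) (by rw [← hg']; exact hg),
    ArtinSchreierProduct.invariantMap_bijective f g hn⟩
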